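/- **Second-order consistency of the 2D conservative cascade semi-Lagrangian (CCSL) scheme.** *Setting.* Let $t_n<t_{n+1}$ and let $\mathbf a:[t_n,t_{n+1}]\times\mathbb R^2\to\mathbb R^2$ be a $C^1$ velocity field with $\nabla_{\mathbf x}\cdot\mathbf a=0$. Let $\mathbf X(t;s,\mathbf x)$ be its characteristics, $\frac{d}{dt}\mathbf X=\mathbf a(t,\mathbf X)$, $\mathbf X(s;s,\mathbf x)=\mathbf x$, for $s,t\in[t_n,t_{n+1}]$, and suppose that $(t,\mathbf x)\mapsto\mathbf X(t;s,\mathbf x)$ is $C^2$ for each $s$. Let $f$ be a $C^2$ function of $(t,x,y)\in[t_n,t_{n+1}]\times\mathbb R^2$ with $\partial_t f+\nabla_{\mathbf x}\cdot(\mathbf a f)=0$. Put $\Phi=(\Phi_1,\Phi_2)=\mathbf X(t_n;t_{n+1},\cdot)$. Suppose that for each $\xi$ the map $\mathcal X_\xi(x_0)=\Phi_1(x_0,\xi)$ and for each $\eta$ the map $\mathcal Y_\eta(y_0)=\Phi_2(\eta,y_0)$ is a bijection of $\mathbb R$, and define $$p(x,\xi)=\Phi_2\bigl(\mathcal X_\xi^{-1}(x),\xi\bigr),\qquad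 q(y,\eta)=\Phi_1\bigl(\eta,\mathcal Y_\eta^{-1}(y)\bigr),$$ so that the grid lines $y=\xi$ and $x=\eta$ are traced back to the curves $y=p(x,\xi)$ and $x=q(y,\eta)$. Suppose that $p$ and $q$ are $C^2$ functions on $\mathbb R^2$ with locally Lipschitz second derivatives. *Grid.* Let $\Omega=[x_{\min},x_{\max}]\times[y_{\min},y_{\max}]$ with $x_{\min}<x_{\max}$, $y_{\min}<y_{\max}$. For $h>0$ and $i,j\in\frac12\mathbb Z$ let $x_i=x_{\min}+ih$, $y_j=y_{\min}+jh$, and for $i,j\in\mathbb Z$ let $\Omega_{ij}=[x_{i-1/2},x_{i+1/2}]\times[y_{j-1/2},y_{j+1/2}]$. *1D reconstruction.* Let $d\ge1$ be fixed. On a 1D grid of spacing $h$ with faces $x_{i-1/2}$ and cell averages $u_i$, let $m_i=hu_i$, let $M_j$ be the function on the faces with $M_j(x_{j-1/2})=0$ and $M_j(x_{k+1/2})-M_j(x_{k-1/2})=m_k$ for all $k$, and let $F_j$ be the polynomial of degree at most $2d+1$ that agrees with $M_j$ at the $2d+2$ faces $x_{j-1/2+k}$, $k=-d,\dots,d+1$.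 For given positions $(x^*_{i-1/2})_i$, with $x_{\mu-1/2}\le x^*_{i-1/2}<x_{\mu+1/2}$ and $x_{\lambda-1/2}\le x^*_{i+1/2}<x_{\lambda+1/2}$, the operator $\mathcal T$ returns $$\mathcal T\bigl(\{x^*_{i-1/2}\},\{u_i\}\bigr)_i=F_\lambda(x^*_{i+1/2})+M_\mu(x_{\lambda-1/2})-F_\mu(x^*_{i-1/2}),$$ where $M_\mu(x_{\lambda-1/2})=m_\mu+\dots+m_{\lambda-1}$ if $\mu\le\lambda$. *CCSL update.* Given averages $\overline f^{\,n}_{ij}$, put $\widetilde y_{i-1/2,j-1/2}=p(x_{i-1/2},y_{j-1/2})$, $\overline y_{i,j-1/2}=\frac12(\widetilde y_{i-1/2,j-1/2}+\widetilde y_{i+1/2,j-1/2})$ and $\overline x_{i-1/2,j}=\frac12\bigl(\Phi_1(x_{i-1/2},y_{j-1/2})+\Phi_1(x_{i-1/2},y_{j+1/2})\bigr)$. In each column $i$ let $\{m_{I_{ij}}\}_j=\mathcal T(\{\overline y_{i,j-1/2}\}_j,\{h\overline f^{\,n}_{ij}\}_j)$; then in each row $j$ let $\{m_{B_{ij}}\}_i=\mathcal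 T(\{\overline x_{i-1/2,j}\}_i,\{m_{I_{ij}}/h\}_i)$; and put $\overline f^{\,n+1}_{ij}=m_{B_{ij}}/h^2$. *Claim.* There are constants $C>0$ and $h_0>0$, independent of $h$ and of the cell, such that the following holds for all $0<h\le h_0$. If the cell averages at time $t_n$ are exact, $\overline f^{\,n}_{ij}=\frac1{h^2}\iint_{\Omega_{ij}}f(t_n,x,y)\,dx\,dy$ for all $i,j\in\mathbb Z$, then $$\left|\frac1{h^2}\iint_{\Omega_{k,l}}f(t_{n+1},x,y)\,dx\,dy-\overline f^{\,n+1}_{k,l}\right|\le C h^2$$ for all $k,l\in\mathbb Z$ with $(x_k,y_l)\in\Omega$. In particular, when $h=(x_{\max}-x_{\min})/N_x=(y_{\max}-y_{\min})/N_y$, this covers all $k=0,\dots,N_x$ and $l=0,\dots,N_y$. -/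

import Mathlib

noncomputable section

namespace CCSL

/-! ### Transport equation and characteristics in the plane -/

/-- Divergence of a planar vector field. -/
def div (u : ℝ × ℝ → ℝ × ℝ) (z : ℝ × ℝ) : ℝ :=
  (fderiv ℝ u z (1, 0)).1 + (fderiv ℝ u z (0, 1)).2

/-- `f` solves `∂ₜ f + ∇ · (a f) = 0` on `[t₀, t₁] × ℝ²` (one-sided time derivatives at the
end points). -/
def SolvesTransport (a : ℝ → ℝ × ℝ → ℝ × ℝ) (f : ℝ → ℝ × ℝ → ℝ) (t₀ t₁ : ℝ) : Prop :=
  ∀ t ∈ Set.Icc t₀ t₁, ∀ z : ℝ × ℝ,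
    derivWithin (fun τ => f τ z) (Set.Icc t₀ t₁) t + div (fun w => f t w • a t w) z = 0

/-- `X t s x` is the value at time `t` of the characteristic `dX/dt = a(t, X)` that passes
through `x` at time `s`, for `s, t ∈ [t₀, t₁]`. -/
def IsCharacteristicFlow (a : ℝ → ℝ × ℝ → ℝ × ℝ) (X : ℝ → ℝ → ℝ × ℝ → ℝ × ℝ)
    (t₀ t₁ : ℝ) : Prop :=
  ∀ s ∈ Set.Icc t₀ t₁, ∀ x : ℝ × ℝ, X s s x = x ∧
    ∀ t ∈ Set.Icc t₀ t₁,
      HasDerivWithinAt (fun τ => X τ s x) (a t (X t s x)) (Set.Icc t₀ t₁) t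

/-! ### Backtracked grid lines

Below `Φ` is the backtracking map `x ↦ X(tₙ; tₙ₊₁, x)`. -/

/-- `𝒳_ξ(x₀)`: the abscissa at time `tₙ` of the point that is at `(x₀, ξ)` at time `tₙ₊₁`. -/
def xTrace (Φ : ℝ × ℝ → ℝ × ℝ) (ξ x₀ : ℝ) : ℝ := (Φ (x₀, ξ)).1

/-- `𝒴_η(y₀)`: the ordinate at time `tₙ` of the point that is at `(η, y₀)` at time `tₙ₊₁`. -/
def yTrace (Φ : ℝ × ℝ → ℝ × ℝ) (η y₀ : ℝ) : ℝ := (Φ (η, y₀)).2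

/-- `p(x, ξ)`: the backtracked image of the line `y = ξ` is the graph `y = p(x, ξ)`. -/
def pCurve (Φ : ℝ × ℝ → ℝ × ℝ) (w : ℝ × ℝ) : ℝ :=
  (Φ (Function.invFun (xTrace Φ w.2) w.1, w.2)).2

/-- `q(y, η)`: the backtracked image of the line `x = η` is the graph `x = q(y, η)`. -/
def qCurve (Φ : ℝ × ℝ → ℝ × ℝ) (w : ℝ × ℝ) : ℝ :=
  (Φ (w.2, Function.invFun (yTrace Φ w.2) w.1)).1

/-! ### One-dimensional conservative reconstruction

The grid points are `x_i = o + i h` and the cell faces are `x_{i-1/2} = o + (i - 1/2) h`. -/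

/-- The face `x_{i-1/2}`. -/
def face (o h : ℝ) (i : ℤ) : ℝ := o + ((i : ℝ) - 1 / 2) * h

/-- The index `j` such that `x_{j-1/2}` is the nearest face to the left of `x`, that is
`x_{j-1/2} ≤ x < x_{j+1/2}`. -/
def faceIndex (o h x : ℝ) : ℤ := ⌊(x - face o h 0) / h⌋

/-- Signed mass between the faces `x_{j-1/2}` and `x_{k-1/2}`, from the cell masses `m`:
`m_j + ⋯ + m_{k-1}` if `j ≤ k` and `-(m_k + ⋯ + m_{j-1})` if `k ≤ j`. -/
def massBetween (m : ℤ → ℝ) (j k : ℤ) : ℝ :=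
  ∑ c ∈ Finset.Ico j k, m c - ∑ c ∈ Finset.Ico k j, m c

/-- The interpolation polynomial `F_j^{2d+1}`, of degree at most `2d+1`, of the primitive that
vanishes at `x_{j-1/2}`; the nodes are `x_{j-1/2+k}`, `k = -d, …, d+1`. -/
def primitivePoly (d : ℕ) (o h : ℝ) (m : ℤ → ℝ) (j : ℤ) : Polynomial ℝ :=
  Lagrange.interpolate (Finset.Icc (-(d : ℤ)) ((d : ℤ) + 1))
    (fun k => face o h (j + k)) (fun k => massBetween m j (j + k))

/-- The one-dimensional conservative reconstruction operator `𝒯`. From the backtracked faces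
`xs i = x*_{i-1/2}` and the cell averages `avg` it computes the masses
`m*_i ≈ ∫_{x*_{i-1/2}}^{x*_{i+1/2}}`, as `F_λ(x*_{i+1/2}) + (m_μ + ⋯ + m_{λ-1}) - F_μ(x*_{i-1/2})`
where `μ`, `λ` are the cells that contain the two backtracked faces. -/
def reconstruct (d : ℕ) (o h : ℝ) (xs : ℤ → ℝ) (avg : ℤ → ℝ) (i : ℤ) : ℝ :=
  (primitivePoly d o h (fun c => h * avg c) (faceIndex o h (xs (i + 1)))).eval (xs (i + 1))
    + massBetween (fun c => h * avg c) (faceIndex o h (xs i)) (faceIndex o h (xs (i + 1)))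
    - (primitivePoly d o h (fun c => h * avg c) (faceIndex o h (xs i))).eval (xs i)

/-! ### The two-dimensional conservative cascade semi-Lagrangian scheme

The grid is `(x_i, y_j) = (ox + i h, oy + j h)` with `i, j ∈ ℤ`. -/

/-- The cell `Ω_{ij} = [x_{i-1/2}, x_{i+1/2}] × [y_{j-1/2}, y_{j+1/2}]`. -/
def cell (ox oy h : ℝ) (i j : ℤ) : Set (ℝ × ℝ) :=
  Set.Icc (face ox h i) (face ox h (i + 1)) ×ˢ Set.Icc (face oy h j) (face oy h (j + 1))

/-- The average of `g` over `Ω_{ij}`. -/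
def cellAverage (ox oy h : ℝ) (g : ℝ × ℝ → ℝ) (i j : ℤ) : ℝ :=
  1 / h ^ 2 * ∫ z in cell ox oy h i j, g z

/-- The ordinate `ỹ_{i-1/2,j-1/2}` of the intermediate grid point: the intersection of the
backtracked line `y = y_{j-1/2}` with the grid line `x = x_{i-1/2}`. -/
def yTilde (ox oy h : ℝ) (Φ : ℝ × ℝ → ℝ × ℝ) (i j : ℤ) : ℝ :=
  pCurve Φ (face ox h i, face oy h j)

/-- The lower boundary `ȳ_{i,j-1/2}` of the intermediate cell `I_{ij}`. -/
def yBar (ox oy h : ℝ) (Φ : ℝ × ℝ → ℝ × ℝ) (i j : ℤ) : ℝ :=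
  (yTilde ox oy h Φ i j + yTilde ox oy h Φ (i + 1) j) / 2

/-- The left boundary `x̄_{i-1/2,j}` of the backtracked cell `B_{ij}`: the mean abscissa of the
backtracked corners `(x_{i-1/2}, y_{j-1/2})` and `(x_{i-1/2}, y_{j+1/2})`. -/
def xBar (ox oy h : ℝ) (Φ : ℝ × ℝ → ℝ × ℝ) (i j : ℤ) : ℝ :=
  ((Φ (face ox h i, face oy h j)).1 + (Φ (face ox h i, face oy h (j + 1))).1) / 2

/-- The mass of the intermediate cell `I_{ij}`: reconstruction along the column `i`. -/
def intermediateMass (d : ℕ) (ox oy h : ℝ) (Φ : ℝ × ℝ → ℝ × ℝ) (favg : ℤ → ℤ → ℝ)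
    (i j : ℤ) : ℝ :=
  reconstruct d oy h (fun c => yBar ox oy h Φ i c) (fun c => h * favg i c) j

/-- The mass of the backtracked cell `B_{ij}`: reconstruction along the row `j`. -/
def backtrackedMass (d : ℕ) (ox oy h : ℝ) (Φ : ℝ × ℝ → ℝ × ℝ) (favg : ℤ → ℤ → ℝ)
    (i j : ℤ) : ℝ :=
  reconstruct d ox h (fun c => xBar ox oy h Φ c j)
    (fun c => intermediateMass d ox oy h Φ favg c j / h) i

/-- The updated cell averages `f̄_{ij}^{n+1}`, from the cell averages `favg` at time `tₙ`. -/
def update (d : ℕ) (ox oy h : ℝ) (Φ : ℝ × ℝ → ℝ × ℝ) (favg : ℤ → ℤ → ℝ) (i j : ℤ) : ℝ :=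
  backtrackedMass d ox oy h Φ favg i j / h ^ 2

end CCSL

end

/-! Write Φ for the backtracking map. Since `f` is constant along characteristics, the exact average
at `t₁` is the average of `f t₀ ∘ Φ`, and det DΦ = 1 by Liouville's theorem. Differentiating
p(Φ₁(s,τ), τ) = Φ₂(s,τ) and inserting this determinant gives ∂ₛΦ₁ · ∂_ξ p = 1. With g(x,ξ) = f(t₀,
x, p(x,ξ)) ∂_ξ p(x,ξ) this says f(t₀, Φ) = g(Φ₁, τ) ∂ₛΦ₁. The exact mass thus arises from two
one-dimensional substitutions, y = p(x,ξ) in the columns and x = Φ₁(s,τ) in the rows. Each sweep of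
the scheme approximates one of them, so `exists_abs_cascade_sweep_le` serves both.

A sweep makes two errors, each O(h⁴) in mass. Interpolating the primitive reproduces its quadratic
Taylor polynomial, which leaves O(h³) times the strip width h (`exists_abs_reconstruct_strip_le`).
Replacing a curved boundary by the mean of its end points displaces it by O(h) pointwise, but only
by O(h²) on average, by the trapezoidal rule; the cell area supplies the other h²
(`exists_abs_trapezoid_curve_le`).

The first sweep's error passes through the second with a bounded factor, because a backtracked cell
meets boundedly many grid cells (`abs_reconstruct_le`). Dividing the mass error by h² gives the
claim.

Only Taylor expansions with quadratic remainder are needed, hence the class `C11At`, which is the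
regularity that ∂_ξ p has. -/

namespace CCSL

open Topology

/-! ### Functions with Lipschitz derivative. -/

section

variable {E F G : Type*} [PseudoEMetricSpace E] [PseudoEMetricSpace F] [PseudoEMetricSpace G]

/-- `u` is Lipschitz near `x`. -/
def LipschitzNear (u : E → F) (x : E) : Prop :=
  ∃ K, ∃ t ∈ 𝓝 x, LipschitzOnWith K u t

theorem LipschitzNear.continuousAt {u : E → F} {x : E} (hu : LipschitzNear u x) :
    ContinuousAt u x := by
  obtain ⟨K, t, ht, h⟩ := hu
  exact h.continuousOn.continuousAt ht

theorem LipschitzNear.comp {v : F → G} {u : E → F} {x : E} (hv : LipschitzNear v (u x))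
    (hu : LipschitzNear u x) : LipschitzNear (fun y => v (u y)) x := by
  have hc := hu.continuousAt
  obtain ⟨K, t, ht, h⟩ := hu
  obtain ⟨K', t', ht', h'⟩ := hv
  exact ⟨K' * K, t ∩ u ⁻¹' t', Filter.inter_mem ht (hc ht'),
    h'.comp (h.mono Set.inter_subset_left) fun y hy => hy.2⟩

theorem LipschitzNear.prodMk {v : E → G} {u : E → F} {x : E} (hv : LipschitzNear v x)
    (hu : LipschitzNear u x) : LipschitzNear (fun y => (v y, u y)) x := by
  obtain ⟨K, t, ht, h⟩ := hu
  obtain ⟨K', t', ht', h'⟩ := hv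
  exact ⟨max K' K, t' ∩ t, Filter.inter_mem ht' ht,
    (h'.mono Set.inter_subset_left).prodMk (h.mono Set.inter_subset_right)⟩

theorem LipschitzNear.congr {u v : E → F} {x : E} (hu : LipschitzNear u x)
    (h : v =ᶠ[𝓝 x] u) : LipschitzNear v x := by
  obtain ⟨K, t, ht, hK⟩ := hu
  refine ⟨K, t ∩ {y | v y = u y}, Filter.inter_mem ht h, fun y hy z hz => ?_⟩
  rw [hy.2, hz.2]
  exact hK hy.1 hz.1

end

variable {E F G : Type*} [NormedAddCommGroup E] [NormedSpace ℝ E] [NormedAddCommGroup F]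
  [NormedSpace ℝ F] [NormedAddCommGroup G] [NormedSpace ℝ G]

theorem _root_.ContDiffAt.lipschitzNear {u : E → F} {x : E} (hu : ContDiffAt ℝ 1 u x) :
    LipschitzNear u x :=
  hu.exists_lipschitzOnWith

/-- `u` is continuously differentiable near `x`, with a Lipschitz derivative. -/
def C11At (u : E → F) (x : E) : Prop :=
  ContDiffAt ℝ 1 u x ∧ LipschitzNear (fderiv ℝ u) x

theorem _root_.ContDiffAt.c11At {u : E → F} {x : E} (hu : ContDiffAt ℝ 2 u x) : C11At u x :=
  ⟨hu.of_le (by norm_num), (hu.fderiv_right (m := 1) (by norm_num)).lipschitzNear⟩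

/-- Near `x` the derivative is the image of the pair (Dv ∘ u, Du) under composition of linear maps,
a bounded bilinear operation and hence locally Lipschitz. -/
theorem C11At.comp {v : F → G} {u : E → F} {x : E} (hv : C11At v (u x)) (hu : C11At u x) :
    C11At (fun y => v (u y)) x := by
  refine ⟨hv.1.comp x hu.1, ?_⟩
  have hB : ContDiff ℝ 1 fun q : (F →L[ℝ] G) × (E →L[ℝ] F) => q.1.comp q.2 :=
    isBoundedBilinearMap_comp.contDiff
  have hL := LipschitzNear.comp (u := fun y => (fderiv ℝ v (u y), fderiv ℝ u y)) (x := x)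
    hB.contDiffAt.lipschitzNear
    ((LipschitzNear.comp hv.2 hu.1.lipschitzNear).prodMk hu.2)
  refine hL.congr ?_
  have h1 : ∀ᶠ y in 𝓝 x, ContDiffAt ℝ 1 u y := hu.1.eventually (by simp)
  have h2 : ∀ᶠ y in 𝓝 x, ContDiffAt ℝ 1 v (u y) :=
    hu.1.continuousAt.eventually (hv.1.eventually (by simp))
  filter_upwards [h1, h2] with y hy1 hy2
  exact fderiv_fun_comp y (hy2.differentiableAt (by norm_num)) (hy1.differentiableAt (by norm_num))

theorem C11At.prodMk {v : E → G} {u : E → F} {x : E} (hv : C11At v x) (hu : C11At u x) :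
    C11At (fun y => (v y, u y)) x := by
  refine ⟨hv.1.prodMk hu.1, ?_⟩
  have hB : ContDiff ℝ 1 fun q : (E →L[ℝ] G) × (E →L[ℝ] F) => q.1.prod q.2 :=
    (ContinuousLinearMap.prodₗᵢ ℝ :
      (E →L[ℝ] G) × (E →L[ℝ] F) ≃ₗᵢ[ℝ] E →L[ℝ] G × F).contDiff
  have hL := LipschitzNear.comp (u := fun y => (fderiv ℝ v y, fderiv ℝ u y)) (x := x)
    hB.contDiffAt.lipschitzNear
    (hv.2.prodMk hu.2)
  refine hL.congr ?_
  have h1 : ∀ᶠ y in 𝓝 x, ContDiffAt ℝ 1 u y := hu.1.eventually (by simp)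
  have h2 : ∀ᶠ y in 𝓝 x, ContDiffAt ℝ 1 v y := hv.1.eventually (by simp)
  filter_upwards [h1, h2] with y hy1 hy2
  exact (hy2.differentiableAt (by norm_num)).fderiv_prodMk (hy1.differentiableAt (by norm_num))

theorem C11At.mul {u v : E → ℝ} {x : E} (hu : C11At u x) (hv : C11At v x) :
    C11At (fun y => u y * v y) x :=
  C11At.comp (v := fun q : ℝ × ℝ => q.1 * q.2)
    (ContDiff.contDiffAt (contDiff_fst.mul contDiff_snd)).c11At (hu.prodMk hv)

theorem C11At.inv {u : E → ℝ} {x : E} (hu : C11At u x) (h : u x ≠ 0) :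
    C11At (fun y => (u y)⁻¹) x :=
  C11At.comp (v := fun r : ℝ => r⁻¹) (contDiffAt_inv ℝ h).c11At hu

/-- The constant `K` bounds `u` and its Lipschitz and second-order Taylor constants on the closed
ball of radius `R`. -/
structure C11Bound (u : E → ℝ) (R K : ℝ) : Prop where
  nonneg : 0 ≤ K
  abs_le : ∀ z, ‖z‖ ≤ R → |u z| ≤ K
  abs_sub_le : ∀ z w, ‖z‖ ≤ R → ‖w‖ ≤ R → |u w - u z| ≤ K * ‖w - z‖
  fderiv_le : ∀ z, ‖z‖ ≤ R → ‖fderiv ℝ u z‖ ≤ K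
  fderiv_sub_le : ∀ z w, ‖z‖ ≤ R → ‖w‖ ≤ R → ‖fderiv ℝ u w - fderiv ℝ u z‖ ≤ K * ‖w - z‖
  taylor : ∀ z w, ‖z‖ ≤ R → ‖w‖ ≤ R → |u w - u z - fderiv ℝ u z (w - z)| ≤ K * ‖w - z‖ ^ 2

theorem C11Bound.mono {u : E → ℝ} {R R' K K' : ℝ} (h : C11Bound u R K) (hR : R' ≤ R)
    (hK : K ≤ K') : C11Bound u R' K' where
  nonneg := h.nonneg.trans hK
  abs_le z hz := (h.abs_le z (hz.trans hR)).trans hK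
  abs_sub_le z w hz hw := (h.abs_sub_le z w (hz.trans hR) (hw.trans hR)).trans (by gcongr)
  fderiv_le z hz := (h.fderiv_le z (hz.trans hR)).trans hK
  fderiv_sub_le z w hz hw := (h.fderiv_sub_le z w (hz.trans hR) (hw.trans hR)).trans (by gcongr)
  taylor z w hz hw := (h.taylor z w (hz.trans hR) (hw.trans hR)).trans (by gcongr)

/-- Closed balls are compact, so local Lipschitz constants become uniform; this is what makes the
final constant independent of the cell. -/
theorem exists_c11Bound [ProperSpace E] {u : E → ℝ} (hu : ∀ x, C11At u x) (R : ℝ) :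
    ∃ K, C11Bound u R K := by
  have hc1 : ContDiff ℝ 1 u := contDiff_iff_contDiffAt.2 fun x => (hu x).1
  have hcd : Continuous (fderiv ℝ u) := hc1.continuous_fderiv (by norm_num)
  have hk : IsCompact (Metric.closedBall (0 : E) R) := isCompact_closedBall _ _
  have hloc : LocallyLipschitz (fderiv ℝ u) := fun x => (hu x).2
  obtain ⟨K₁, hK₁⟩ := hk.exists_bound_of_continuousOn hc1.continuous.continuousOn
  obtain ⟨K₂, hK₂⟩ := hk.exists_bound_of_continuousOn hcd.continuousOn
  obtain ⟨K₃, hK₃⟩ := hloc.locallyLipschitzOn.exists_lipschitzOnWith_of_compact hk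
  have hmem : ∀ {z : E}, ‖z‖ ≤ R → z ∈ Metric.closedBall (0 : E) R := fun h => by simpa using h
  have hd : ∀ x, DifferentiableAt ℝ u x := fun x => hc1.differentiable (by norm_num) x
  set K := max (max K₁ K₂) (K₃ : ℝ)
  have h1 : K₁ ≤ K := (le_max_left _ _).trans (le_max_left _ _)
  have h2 : K₂ ≤ K := (le_max_right _ _).trans (le_max_left _ _)
  have h3 : (K₃ : ℝ) ≤ K := le_max_right _ _
  have h0 : 0 ≤ K := K₃.2.trans h3
  have hlip : ∀ z w, ‖z‖ ≤ R → ‖w‖ ≤ R → ‖fderiv ℝ u w - fderiv ℝ u z‖ ≤ K * ‖w - z‖ :=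
    fun z w hz hw => (hK₃.norm_sub_le (hmem hw) (hmem hz)).trans (by gcongr)
  refine ⟨K, h0, fun z hz => (hK₁ z (hmem hz)).trans h1, fun z w hz hw => ?_,
    fun z hz => (hK₂ z (hmem hz)).trans h2, hlip, fun z w hz hw => ?_⟩
  · exact (convex_closedBall (0 : E) R).norm_image_sub_le_of_norm_fderiv_le (𝕜 := ℝ)
      (fun x _ => hd x) (fun x hx => (hK₂ x hx).trans h2) (hmem hz) (hmem hw)
  -- On this convex set the derivative differs from its value at `z` by at most `K * ‖w - z‖`, so
  -- the mean value inequality yields the quadratic remainder.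
  · have hs : Convex ℝ (Metric.closedBall (0 : E) R ∩ Metric.closedBall z ‖w - z‖) :=
      (convex_closedBall _ _).inter (convex_closedBall _ _)
    have := hs.norm_image_sub_le_of_norm_fderiv_le' (𝕜 := ℝ) (f := u) (φ := fderiv ℝ u z)
      (C := K * ‖w - z‖) (x := z) (y := w) (fun x _ => hd x) (fun x hx => ?_)
      ⟨hmem hz, by simp⟩ ⟨hmem hw, by simp [dist_eq_norm]⟩
    · calc _ ≤ _ := this
        _ = _ := by ring
    · refine (hlip z x hz (by simpa using hx.1)).trans ?_
      gcongr
      simpa [dist_eq_norm] using hx.2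

/-- The partial derivatives of a `C²` function with locally Lipschitz second derivative are
`C^{1,1}`. -/
theorem c11At_fderiv_apply {u : E → F} (hu : ContDiff ℝ 2 u)
    (hu' : LocallyLipschitz (iteratedFDeriv ℝ 2 u)) (e x : E) :
    C11At (fun z => fderiv ℝ u z e) x := by
  have h1 : ContDiff ℝ 1 (fderiv ℝ u) := hu.fderiv_right (by norm_num)
  refine ⟨(h1.clm_apply contDiff_const).contDiffAt, ?_⟩
  obtain ⟨K, t, ht, hK⟩ := hu' x
  refine ⟨K * ‖e‖₊, t, ht, LipschitzOnWith.of_dist_le_mul fun z hz w hw => ?_⟩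
  rw [dist_eq_norm]
  refine ContinuousLinearMap.opNorm_le_bound _ (by positivity) fun v => ?_
  have hf : ∀ z, fderiv ℝ (fun z => fderiv ℝ u z e) z v = iteratedFDeriv ℝ 2 u z ![v, e] := by
    intro z
    rw [iteratedFDeriv_two_apply]
    have := ((h1.differentiable (by norm_num) z).hasFDerivAt.clm_apply
      (hasFDerivAt_const e z)).fderiv
    rw [this]
    simp
  rw [sub_apply, hf, hf, ← sub_apply]
  refine (ContinuousMultilinearMap.le_opNorm _ _).trans ?_
  have := hK.dist_le_mul z hz w hw
  rw [dist_eq_norm] at this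
  simp only [Fin.prod_univ_two, Matrix.cons_val_zero, Matrix.cons_val_one]
  calc _ ≤ (K * dist z w) * (‖v‖ * ‖e‖) := by gcongr
    _ = _ := by push_cast; ring

end CCSL

/-! ### Stability and consistency of the one-dimensional reconstruction. -/

namespace CCSL

open Polynomial intervalIntegral

theorem face_add (o h : ℝ) (j k : ℤ) : face o h (j + k) = face o h j + k * h := by
  simp only [face]; push_cast; ring

theorem face_add_one (o h : ℝ) (j : ℤ) : face o h (j + 1) = face o h j + h := by
  simpa using face_add o h j 1

theorem face_faceIndex_le {h : ℝ} (hh : 0 < h) (o x : ℝ) : face o h (faceIndex o h x) ≤ x := by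
  have h1 : face o h (faceIndex o h x) = face o h 0 + faceIndex o h x * h := by
    simpa using face_add o h 0 (faceIndex o h x)
  have h2 := (le_div_iff₀ hh).1 (Int.floor_le ((x - face o h 0) / h))
  rw [h1]
  unfold faceIndex
  linarith

theorem lt_face_faceIndex_add {h : ℝ} (hh : 0 < h) (o x : ℝ) :
    x < face o h (faceIndex o h x) + h := by
  have h1 : face o h (faceIndex o h x) = face o h 0 + faceIndex o h x * h := by
    simpa using face_add o h 0 (faceIndex o h x)
  have h2 := (div_lt_iff₀ hh).1 (Int.lt_floor_add_one ((x - face o h 0) / h))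
  rw [h1]
  unfold faceIndex
  linarith

theorem sum_Ico_int_sub (W : ℤ → ℝ) {j k : ℤ} (hjk : j ≤ k) :
    ∑ c ∈ Finset.Ico j k, (W (c + 1) - W c) = W k - W j := by
  induction k, hjk using Int.leInduction with
  | base => simp
  | succ k hk ih =>
    have : Finset.Ico j (k + 1) = insert k (Finset.Ico j k) := by
      ext c; simp only [Finset.mem_insert, Finset.mem_Ico]; omega
    rw [this, Finset.sum_insert (by simp), ih]
    ring

/-- Telescoping; the signed convention makes it valid in either order of the indices. -/
theorem massBetween_eq_sub {m W : ℤ → ℝ} (hm : ∀ c, m c = W (c + 1) - W c) (j k : ℤ) :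
    massBetween m j k = W k - W j := by
  simp only [massBetween, hm]
  rcases le_total j k with h | h
  · rw [sum_Ico_int_sub W h, Finset.Ico_eq_empty_of_le h, Finset.sum_empty, sub_zero]
  · rw [sum_Ico_int_sub W h, Finset.Ico_eq_empty_of_le h, Finset.sum_empty]
    ring

theorem massBetween_sub (m m' : ℤ → ℝ) (j k : ℤ) :
    massBetween (fun c => m c - m' c) j k = massBetween m j k - massBetween m' j k := by
  simp only [massBetween, Finset.sum_sub_distrib]
  ring

theorem abs_massBetween_le {m : ℤ → ℝ} {ε : ℝ} {j k : ℤ}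
    (hm : ∀ c, min j k ≤ c → c < max j k → |m c| ≤ ε) :
    |massBetween m j k| ≤ |(k : ℝ) - j| * ε := by
  have key : ∀ j k : ℤ, j ≤ k → (∀ c, j ≤ c → c < k → |m c| ≤ ε) →
      |∑ c ∈ Finset.Ico j k, m c| ≤ ((k : ℝ) - j) * ε := by
    intro j k hjk hc
    refine (Finset.abs_sum_le_sum_abs _ _).trans ?_
    refine (Finset.sum_le_card_nsmul _ _ ε fun c hc' => ?_).trans_eq ?_
    · rw [Finset.mem_Ico] at hc'
      exact hc c hc'.1 hc'.2
    · rw [Int.card_Ico, nsmul_eq_mul]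
      congr 1
      have : ((k - j).toNat : ℤ) = k - j := Int.toNat_of_nonneg (by omega)
      exact_mod_cast this
  unfold massBetween
  rcases le_total j k with h | h
  · rw [Finset.Ico_eq_empty_of_le h, Finset.sum_empty, sub_zero,
      abs_of_nonneg (sub_nonneg.2 (Int.cast_le.2 h) : (0 : ℝ) ≤ (k : ℝ) - j)]
    exact key j k h fun c h1 h2 => hm c (by omega) (by omega)
  · rw [Finset.Ico_eq_empty_of_le h, Finset.sum_empty, zero_sub, abs_neg,
      abs_sub_comm (k : ℝ), abs_of_nonneg (sub_nonneg.2 (Int.cast_le.2 h) : (0 : ℝ) ≤ (j : ℝ) - k)]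
    exact key k j h fun c h1 h2 => hm c (by omega) (by omega)

/-- A bound for the Lebesgue constant of interpolation at `2d+2` equidistant nodes, on the central
interval. -/
def lebesgueBound (d : ℕ) : ℝ := (2 * d + 2) * (d + 1) ^ (2 * d + 1)

theorem lebesgueBound_nonneg (d : ℕ) : 0 ≤ lebesgueBound d := by
  unfold lebesgueBound; positivity

theorem card_stencil (d : ℕ) : (Finset.Icc (-(d : ℤ)) ((d : ℤ) + 1)).card = 2 * d + 2 := by
  rw [Int.card_Icc]; omega

theorem face_add_injective {h : ℝ} (hh : 0 < h) (o : ℝ) (j : ℤ) :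
    Function.Injective fun k => face o h (j + k) := by
  intro k l hkl
  simp only [face_add] at hkl
  have : (k : ℝ) = l := mul_right_cancel₀ hh.ne' (add_left_cancel hkl)
  exact_mod_cast this

theorem abs_face_sub_le {d : ℕ} {o h x : ℝ} (hh : 0 < h) {j k : ℤ}
    (hk : k ∈ Finset.Icc (-(d : ℤ)) ((d : ℤ) + 1)) (hx : face o h j ≤ x)
    (hx' : x ≤ face o h j + h) : |x - face o h (j + k)| ≤ (d + 1) * h := by
  rw [Finset.mem_Icc] at hk
  have h1 : -(d : ℝ) ≤ k := by exact_mod_cast hk.1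
  have h2 : (k : ℝ) ≤ d + 1 := by exact_mod_cast hk.2
  rw [face_add, abs_le]
  constructor <;> nlinarith

theorem abs_eval_interpolate_le (d : ℕ) {o h x ε : ℝ} (hh : 0 < h) {j : ℤ}
    (hx : face o h j ≤ x) (hx' : x ≤ face o h j + h) {r : ℤ → ℝ}
    (hr : ∀ k ∈ Finset.Icc (-(d : ℤ)) ((d : ℤ) + 1), |r k| ≤ ε) :
    |(Lagrange.interpolate (Finset.Icc (-(d : ℤ)) ((d : ℤ) + 1))
      (fun k => face o h (j + k)) r).eval x| ≤ lebesgueBound d * ε := by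
  set s := Finset.Icc (-(d : ℤ)) ((d : ℤ) + 1) with hs
  -- Each of the `2d + 1` factors has numerator at most `(d + 1) h` and denominator at least `h`.
  have hbasis : ∀ k ∈ s, |(Lagrange.basis s (fun k => face o h (j + k)) k).eval x|
      ≤ ((d : ℝ) + 1) ^ (2 * d + 1) := by
    intro k hk
    have hcard : (s.erase k).card = 2 * d + 1 := by
      rw [Finset.card_erase_of_mem hk, card_stencil]; omega
    rw [Lagrange.basis, eval_prod, Finset.abs_prod, ← hcard, ← Finset.prod_const]
    refine Finset.prod_le_prod (fun _ _ => abs_nonneg _) fun l hl => ?_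
    rw [Finset.mem_erase] at hl
    have h1 := abs_face_sub_le hh (hs ▸ hl.2) hx hx'
    have h2 : h ≤ |face o h (j + k) - face o h (j + l)| := by
      have h3 : (1 : ℝ) ≤ |(k : ℝ) - l| := by
        exact_mod_cast Int.one_le_abs (sub_ne_zero.2 hl.1.symm)
      rw [face_add, face_add, show ∀ a : ℝ, a + k * h - (a + l * h) = (k - l) * h by
        intro a; ring, abs_mul, abs_of_pos hh]
      nlinarith
    simp only [Lagrange.basisDivisor, eval_mul, eval_C, eval_sub, eval_X, abs_mul, abs_inv]
    calc _ ≤ h⁻¹ * ((d + 1) * h) := by gcongr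
      _ = _ := by field_simp
  rw [Lagrange.interpolate_apply, eval_finsetSum]
  refine (Finset.abs_sum_le_sum_abs _ _).trans ?_
  refine (Finset.sum_le_card_nsmul _ _ (ε * ((d : ℝ) + 1) ^ (2 * d + 1)) fun k hk => ?_).trans_eq ?_
  · rw [eval_mul, eval_C, abs_mul]
    have h0 : 0 ≤ ε := (abs_nonneg _).trans (hr k hk)
    exact mul_le_mul (hr k hk) (hbasis k hk) (abs_nonneg _) h0
  · rw [card_stencil, nsmul_eq_mul, lebesgueBound]
    push_cast; ring

theorem primitivePoly_sub (d : ℕ) (o h : ℝ) (m m' : ℤ → ℝ) (j : ℤ) :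
    primitivePoly d o h (fun c => m c - m' c) j
      = primitivePoly d o h m j - primitivePoly d o h m' j := by
  simp only [primitivePoly, ← map_sub]
  congr 1
  ext k
  simp [massBetween_sub]

/-- Linearity in the averages turns the stability bound into a bound on error propagation. -/
theorem reconstruct_sub (d : ℕ) (o h : ℝ) (xs u v : ℤ → ℝ) (i : ℤ) :
    reconstruct d o h xs (fun c => u c - v c) i
      = reconstruct d o h xs u i - reconstruct d o h xs v i := by
  simp only [reconstruct, mul_sub, massBetween_sub, primitivePoly_sub, eval_sub]
  ring

theorem abs_eval_primitivePoly_le (d : ℕ) {o h x ε : ℝ} (hh : 0 < h) {j : ℤ}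
    (hx : face o h j ≤ x) (hx' : x ≤ face o h j + h) {m : ℤ → ℝ} (hε : 0 ≤ ε)
    (hm : ∀ c, j - d ≤ c → c ≤ j + d → |m c| ≤ ε) :
    |(primitivePoly d o h m j).eval x| ≤ lebesgueBound d * ((d + 1) * ε) := by
  refine abs_eval_interpolate_le d hh hx hx' fun k hk => ?_
  rw [Finset.mem_Icc] at hk
  refine (abs_massBetween_le (ε := ε) fun c h1 h2 => hm c (by omega) (by omega)).trans ?_
  gcongr
  have h1 : -(d : ℝ) ≤ k := by exact_mod_cast hk.1
  have h2 : (k : ℝ) ≤ d + 1 := by exact_mod_cast hk.2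
  rw [abs_le]; push_cast
  constructor <;> linarith

/-- Stability of the reconstruction with respect to the cell masses. -/
theorem abs_reconstruct_le (d : ℕ) {o h ε L : ℝ} (hh : 0 < h) (hε : 0 ≤ ε) {xs u : ℤ → ℝ} {i : ℤ}
    (hL : |xs (i + 1) - xs i| ≤ L * h)
    (hu : ∀ c, min (xs i) (xs (i + 1)) - (d + 1) * h ≤ face o h c →
      face o h c ≤ max (xs i) (xs (i + 1)) + d * h → |h * u c| ≤ ε) :
    |reconstruct d o h xs u i| ≤ (2 * lebesgueBound d * (d + 1) + L + 1) * ε := by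
  have hface : ∀ j c : ℤ, face o h c = face o h j + ((c : ℝ) - j) * h := fun j c => by
    simpa using face_add o h j (c - j)
  have a1 := face_faceIndex_le hh o (xs i)
  have a2 := lt_face_faceIndex_add hh o (xs i)
  have b1 := face_faceIndex_le hh o (xs (i + 1))
  have b2 := lt_face_faceIndex_add hh o (xs (i + 1))
  set μ := faceIndex o h (xs i)
  set l := faceIndex o h (xs (i + 1))
  -- The nearest left face lies up to `h` below the position and never above it; this is why the
  -- window for `u` reaches `(d + 1) h` to the left but only `d h` to the right.
  have hstencil : ∀ j c : ℤ, j - d ≤ c → c ≤ j + d →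
      face o h j - d * h ≤ face o h c ∧ face o h c ≤ face o h j + d * h := by
    intro j c h1 h2
    have h1' : (j : ℝ) - d ≤ c := by exact_mod_cast h1
    have h2' : (c : ℝ) ≤ j + d := by exact_mod_cast h2
    rw [hface j c]
    constructor <;> nlinarith
  have e1 : |(primitivePoly d o h (fun c => h * u c) l).eval (xs (i + 1))|
      ≤ lebesgueBound d * ((d + 1) * ε) := by
    refine abs_eval_primitivePoly_le d hh b1 b2.le hε fun c h1 h2 => hu c ?_ ?_
    · have := (hstencil l c h1 h2).1
      linarith [min_le_right (xs i) (xs (i + 1))]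
    · have := (hstencil l c h1 h2).2
      linarith [le_max_right (xs i) (xs (i + 1))]
  have e2 : |(primitivePoly d o h (fun c => h * u c) μ).eval (xs i)|
      ≤ lebesgueBound d * ((d + 1) * ε) := by
    refine abs_eval_primitivePoly_le d hh a1 a2.le hε fun c h1 h2 => hu c ?_ ?_
    · have := (hstencil μ c h1 h2).1
      linarith [min_le_left (xs i) (xs (i + 1))]
    · have := (hstencil μ c h1 h2).2
      linarith [le_max_left (xs i) (xs (i + 1))]
  have hd0 : 0 ≤ (d : ℝ) * h := by positivity
  have e3 : |massBetween (fun c => h * u c) μ l| ≤ |(l : ℝ) - μ| * ε := by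
    refine abs_massBetween_le fun c h1 h2 => hu c ?_ ?_
    · have : min (face o h μ) (face o h l) ≤ face o h c := by
        rcases min_le_iff.1 h1 with h | h
        · refine min_le_of_left_le ?_
          have : (μ : ℝ) ≤ c := by exact_mod_cast h
          rw [hface μ c]; nlinarith
        · refine min_le_of_right_le ?_
          have : (l : ℝ) ≤ c := by exact_mod_cast h
          rw [hface l c]; nlinarith
      have h3 : min (xs i) (xs (i + 1)) - h ≤ min (face o h μ) (face o h l) :=
        le_min (by linarith [min_le_left (xs i) (xs (i + 1))])
          (by linarith [min_le_right (xs i) (xs (i + 1))])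
      linarith
    · have : face o h c ≤ max (face o h μ) (face o h l) := by
        rcases lt_max_iff.1 h2 with h | h
        · refine le_max_of_le_left ?_
          have : (c : ℝ) ≤ μ := by exact_mod_cast h.le
          rw [hface μ c]; nlinarith
        · refine le_max_of_le_right ?_
          have : (c : ℝ) ≤ l := by exact_mod_cast h.le
          rw [hface l c]; nlinarith
      have h3 : max (face o h μ) (face o h l) ≤ max (xs i) (xs (i + 1)) := max_le_max a1 b1
      linarith
  -- Rounding both positions down to faces changes their difference by at most one cell.
  have e4 : |(l : ℝ) - μ| ≤ L + 1 := by
    have h1 := hface μ l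
    have h2 : |((l : ℝ) - μ) * h| ≤ (L + 1) * h := by
      rw [abs_le] at hL ⊢
      constructor <;> linarith [hL.1, hL.2]
    rw [abs_mul, abs_of_pos hh] at h2
    exact le_of_mul_le_mul_right h2 hh
  have e5 : |(l : ℝ) - μ| * ε ≤ (L + 1) * ε := by gcongr
  unfold reconstruct
  rw [abs_le] at e1 e2 e3 ⊢
  constructor <;> linarith [e1.1, e1.2, e2.1, e2.2, e3.1, e3.2]

/-- Interpolation error of the primitive of a function with a second-order Taylor expansion. -/
theorem abs_eval_primitivePoly_sub_integral_le {d : ℕ} (hd : 1 ≤ d) {o h x : ℝ} (hh : 0 < h)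
    {j : ℤ} (hx : face o h j ≤ x) (hx' : x ≤ face o h j + h) {m : ℤ → ℝ} {w : ℝ → ℝ}
    (hw : Continuous w) (hm : ∀ c, m c = ∫ y in face o h c..face o h (c + 1), w y) {A B K : ℝ}
    (hK : ∀ y, |y - face o h j| ≤ (d + 1) * h →
      |w y - (A + B * (y - face o h j))| ≤ K * (y - face o h j) ^ 2) :
    |(primitivePoly d o h m j).eval x - ∫ y in face o h j..x, w y|
      ≤ (lebesgueBound d + 1) * (K * ((d + 1) * h) ^ 3) := by
  set a := face o h j with ha
  have hii : ∀ p q, IntervalIntegrable w MeasureTheory.volume p q := fun p q =>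
    hw.intervalIntegrable p q
  -- The primitive of the affine approximation of `w`; it is its own interpolant, so only the
  -- remainder at the nodes is amplified by the Lebesgue constant.
  set T : ℝ[X] := C A * (X - C a) + C (B / 2) * (X - C a) ^ 2 with hT
  have hTint : ∀ y, T.eval y = ∫ z in a..y, (A + B * (z - a)) := by
    intro y
    rw [intervalIntegral.integral_add (by simp) (Continuous.intervalIntegrable (by fun_prop) _ _),
      intervalIntegral.integral_const_mul, intervalIntegral.integral_comp_sub_right (fun z => z),
      integral_id]
    simp [hT]
    ring
  have hrem : ∀ y, |y - a| ≤ (d + 1) * h →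
      |(∫ z in a..y, w z) - T.eval y| ≤ K * ((d + 1) * h) ^ 3 := by
    intro y hy
    have hK0 : 0 ≤ K := by
      have := hK (a + h) (by rw [add_sub_cancel_left, abs_of_pos hh]; nlinarith [hh, (Nat.cast_nonneg d : (0:ℝ) ≤ d)])
      have h2 : 0 ≤ K * (a + h - a) ^ 2 := (abs_nonneg _).trans this
      rw [add_sub_cancel_left] at h2
      exact nonneg_of_mul_nonneg_left h2 (by positivity)
    rw [hTint, ← intervalIntegral.integral_sub (hii _ _)
      (Continuous.intervalIntegrable (by fun_prop) _ _)]
    have := intervalIntegral.norm_integral_le_of_norm_le_const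
      (f := fun z => w z - (A + B * (z - a))) (a := a) (b := y) (C := K * ((d + 1) * h) ^ 2) ?_
    · rw [Real.norm_eq_abs] at this
      refine this.trans ?_
      calc _ ≤ K * ((d + 1) * h) ^ 2 * ((d + 1) * h) := by gcongr
        _ = _ := by ring
    · intro z hz
      have hz' : |z - a| ≤ (d + 1) * h :=
        (Set.abs_sub_left_of_mem_uIcc (Set.uIoc_subset_uIcc hz)).trans hy
      rw [Real.norm_eq_abs]
      refine (hK z hz').trans ?_
      rw [← sq_abs (z - a)]
      gcongr
  have hval : ∀ k, massBetween m j (j + k) = ∫ z in a..face o h (j + k), w z := by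
    intro k
    rw [massBetween_eq_sub (W := fun c => ∫ z in a..face o h c, w z) (fun c => ?_)]
    · simp [ha]
    · rw [hm, intervalIntegral.integral_interval_sub_left (hii _ _) (hii _ _)]
  -- Here `1 ≤ d` enters: a quadratic must be reproduced from `2d + 2` nodes.
  have hdeg : T.degree < (Finset.Icc (-(d : ℤ)) ((d : ℤ) + 1)).card := by
    rw [card_stencil]
    refine lt_of_le_of_lt (b := (2 : WithBot ℕ)) ?_ (by exact_mod_cast (by omega : 2 < 2 * d + 2))
    rw [hT]
    compute_degree
  have hTeq := Lagrange.eq_interpolate (s := Finset.Icc (-(d : ℤ)) ((d : ℤ) + 1))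
    (v := fun k => face o h (j + k)) ((face_add_injective hh o j).injOn) hdeg
  have e1 : |(primitivePoly d o h m j).eval x - T.eval x|
      ≤ lebesgueBound d * (K * ((d + 1) * h) ^ 3) := by
    rw [hTeq, primitivePoly, ← eval_sub, ← map_sub]
    refine abs_eval_interpolate_le d hh hx hx' fun k hk => ?_
    rw [Pi.sub_apply, hval]
    refine hrem _ ?_
    rw [abs_sub_comm]
    exact abs_face_sub_le hh hk le_rfl (by linarith)
  have e2 := hrem x (by
    rw [abs_of_nonneg (by linarith)]
    nlinarith [(Nat.cast_nonneg d : (0 : ℝ) ≤ d)])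
  rw [abs_le] at e1 e2 ⊢
  constructor <;> linarith [e1.1, e1.2, e2.1, e2.2]

/-- Consistency of the reconstruction for exact cell masses. -/
theorem abs_reconstruct_sub_integral_le {d : ℕ} (hd : 1 ≤ d) {o h : ℝ} (hh : 0 < h)
    {xs u : ℤ → ℝ} {i : ℤ} {w : ℝ → ℝ} (hw : Continuous w)
    (hu : ∀ c, h * u c = ∫ y in face o h c..face o h (c + 1), w y) {K : ℝ}
    (hK : ∀ a, (|a - xs i| ≤ h ∨ |a - xs (i + 1)| ≤ h) → ∃ A B : ℝ, ∀ y, |y - a| ≤ (d + 1) * h →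
      |w y - (A + B * (y - a))| ≤ K * (y - a) ^ 2) :
    |reconstruct d o h xs u i - ∫ y in xs i..xs (i + 1), w y|
      ≤ 2 * ((lebesgueBound d + 1) * (K * ((d + 1) * h) ^ 3)) := by
  have hii : ∀ p q, IntervalIntegrable w MeasureTheory.volume p q := fun p q =>
    hw.intervalIntegrable p q
  have a1 := face_faceIndex_le hh o (xs i)
  have a2 := lt_face_faceIndex_add hh o (xs i)
  have b1 := face_faceIndex_le hh o (xs (i + 1))
  have b2 := lt_face_faceIndex_add hh o (xs (i + 1))
  unfold reconstruct
  set μ := faceIndex o h (xs i)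
  set l := faceIndex o h (xs (i + 1))
  -- The expansions are centred at the faces left of the two positions, which lie within `h` of
  -- them.
  obtain ⟨A, B, hAB⟩ := hK (face o h μ) (.inl (by rw [abs_le]; constructor <;> linarith))
  obtain ⟨A', B', hAB'⟩ := hK (face o h l) (.inr (by rw [abs_le]; constructor <;> linarith))
  have e1 := abs_eval_primitivePoly_sub_integral_le hd hh a1 a2.le hw hu hAB
  have e2 := abs_eval_primitivePoly_sub_integral_le hd hh b1 b2.le hw hu hAB'
  have e3 : massBetween (fun c => h * u c) μ l = ∫ z in face o h μ..face o h l, w z := by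
    rw [massBetween_eq_sub (W := fun c => ∫ z in face o h μ..face o h c, w z) (fun c => ?_)]
    · simp
    · rw [hu, intervalIntegral.integral_interval_sub_left (hii _ _) (hii _ _)]
  have e4 : ∫ y in xs i..xs (i + 1), w y = (∫ z in face o h μ..face o h l, w z)
      + (∫ z in face o h l..xs (i + 1), w z) - ∫ z in face o h μ..xs i, w z := by
    rw [intervalIntegral.integral_add_adjacent_intervals (hii _ _) (hii _ _),
      intervalIntegral.integral_interval_sub_left (hii _ _) (hii _ _)]
  rw [e3, e4]
  rw [abs_le] at e1 e2 ⊢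
  constructor <;> linarith [e1.1, e1.2, e2.1, e2.2]

end CCSL

/-! ### Accuracy of one sweep of the cascade. -/

namespace CCSL

open intervalIntegral MeasureTheory

theorem continuous_integral_snd {G : ℝ × ℝ → ℝ} (hG : Continuous G) (σ τ : ℝ) :
    Continuous fun x => ∫ s in σ..τ, G (x, s) :=
  intervalIntegral.continuous_parametric_intervalIntegral_of_continuous' (by fun_prop) _ _

theorem integral_swap_of_continuous {G : ℝ × ℝ → ℝ} (hG : Continuous G) (a b c d : ℝ) :
    ∫ x in a..b, ∫ y in c..d, G (x, y) = ∫ y in c..d, ∫ x in a..b, G (x, y) :=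
  intervalIntegral_intervalIntegral_swap (F := fun x y => G (x, y))
    ((hG.continuousOn.integrableOn_compact
      (isCompact_uIcc.prod isCompact_uIcc)).mono_set
      (Set.prod_mono Set.uIoc_subset_uIcc Set.uIoc_subset_uIcc))

theorem c11_continuous {E : Type*} [NormedAddCommGroup E] [NormedSpace ℝ E] {G : E → ℝ}
    (hG : ∀ z, C11At G z) : Continuous G :=
  continuous_iff_continuousAt.2 fun z => (hG z).1.continuousAt

theorem c11_continuous_fderiv {E : Type*} [NormedAddCommGroup E] [NormedSpace ℝ E] {G : E → ℝ}
    (hG : ∀ z, C11At G z) : Continuous (fderiv ℝ G) :=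
  continuous_iff_continuousAt.2 fun z => (hG z).2.continuousAt

theorem abs_intervalIntegral_le {u : ℝ → ℝ} {a h C : ℝ} (hh : 0 ≤ h)
    (hu : ∀ x, a ≤ x → x ≤ a + h → |u x| ≤ C) : |∫ x in a..a + h, u x| ≤ C * h := by
  have := intervalIntegral.norm_integral_le_of_norm_le_const (f := u) (a := a) (b := a + h)
    (C := C) fun x hx => by
      rw [Set.uIoc_of_le (by linarith)] at hx
      exact hu x hx.1.le hx.2
  simpa [abs_of_nonneg hh] using this

theorem norm_mk_le {a b R : ℝ} (ha : |a| ≤ R) (hb : |b| ≤ R) : ‖((a, b) : ℝ × ℝ)‖ ≤ R := by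
  rw [Prod.norm_mk]; exact max_le ha hb

theorem apply_fst_eq (L : ℝ × ℝ →L[ℝ] ℝ) (a : ℝ) : L (a, 0) = L (1, 0) * a := by
  rw [show ((a, 0) : ℝ × ℝ) = a • ((1, 0) : ℝ × ℝ) by simp, map_smul, smul_eq_mul, mul_comm]

theorem apply_snd_eq (L : ℝ × ℝ →L[ℝ] ℝ) (a : ℝ) : L (0, a) = L (0, 1) * a := by
  rw [show ((0, a) : ℝ × ℝ) = a • ((0, 1) : ℝ × ℝ) by simp, map_smul, smul_eq_mul, mul_comm]

theorem abs_apply_le {L : ℝ × ℝ →L[ℝ] ℝ} {K : ℝ} (hL : ‖L‖ ≤ K) :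
    |L (1, 0)| ≤ K := by
  refine (L.le_opNorm _).trans ?_
  simpa [Prod.norm_mk] using hL

/-- Fourth-order accuracy of the reconstruction of the masses of a strip of width `h`. -/
theorem exists_abs_reconstruct_strip_le {d : ℕ} (hd : 1 ≤ d) {G : ℝ × ℝ → ℝ}
    (hG : ∀ z, C11At G z) (R : ℝ) :
    ∃ K : ℝ, 0 ≤ K ∧ ∀ h, 0 < h → h ≤ 1 → ∀ (o σ : ℝ) (xs u : ℤ → ℝ) (i : ℤ), |σ| ≤ R →
      |xs i| ≤ R → |xs (i + 1)| ≤ R →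
      (∀ c, h * u c = ∫ y in face o h c..face o h (c + 1), ∫ s in σ..σ + h, G (y, s)) →
      |reconstruct d o h xs u i - ∫ y in xs i..xs (i + 1), ∫ s in σ..σ + h, G (y, s)|
        ≤ K * h ^ 4 := by
  -- A face within `h ≤ 1` of a position, then a stencil of reach `(d + 1) h`: in total `R + 1 + (d
  -- + 1)`.
  obtain ⟨K, hK⟩ := exists_c11Bound hG (R + d + 2)
  have hK0 := hK.nonneg
  have hL0 := lebesgueBound_nonneg d
  have hd0 : (0 : ℝ) ≤ d := Nat.cast_nonneg d
  have hGc := c11_continuous hG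
  have hDc := c11_continuous_fderiv hG
  refine ⟨2 * ((lebesgueBound d + 1) * (K * (d + 1) ^ 3)), by positivity, ?_⟩
  intro h hh hh1 o σ xs u i hσ hx hx' hu
  -- Integrating over the strip multiplies the Taylor constant by its width, whence `K * h` and the
  -- fourth power.
  refine (abs_reconstruct_sub_integral_le hd hh (continuous_integral_snd hGc _ _) hu
    (K := K * h) fun a ha => ?_).trans_eq (by ring)
  have ha' : |a| ≤ R + 1 := by
    rcases ha with ha | ha <;> rw [abs_le] at * <;> constructor <;> linarith [hx.1, hx.2, hx'.1, hx'.2]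
  refine ⟨∫ s in σ..σ + h, G (a, s), ∫ s in σ..σ + h, fderiv ℝ G (a, s) (1, 0), fun y hy => ?_⟩
  have hy1 : |y - a| ≤ d + 1 := hy.trans (by nlinarith)
  have hy' : |y| ≤ R + d + 2 := by
    rw [abs_le] at *; constructor <;> linarith [hy1.1, hy1.2, ha'.1, ha'.2]
  rw [← intervalIntegral.integral_mul_const, ← intervalIntegral.integral_add,
    ← intervalIntegral.integral_sub]
  · refine (abs_intervalIntegral_le (C := K * (y - a) ^ 2) hh.le fun s hs hs' => ?_).trans_eq
      (by ring)
    have hs1 : |s| ≤ R + d + 2 := by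
      rw [abs_le] at *; constructor <;> linarith [hσ.1, hσ.2]
    have := hK.taylor (a, s) (y, s) (norm_mk_le (by linarith) hs1) (norm_mk_le hy' hs1)
    rw [Prod.mk_sub_mk, sub_self, apply_fst_eq, Prod.norm_mk] at this
    simp only [norm_zero, Real.norm_eq_abs, abs_nonneg, sup_of_le_left, sq_abs] at this
    rwa [← sub_sub]
  all_goals exact Continuous.intervalIntegrable (by fun_prop) _ _

/-- The error of the trapezoidal rule on one cell, for a function with a first-order Taylor
expansion. -/
theorem abs_integral_trapezoid_le {v : ℝ → ℝ} (hv : Continuous v) {a h A B M : ℝ} (hh : 0 ≤ h)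
    (hM : ∀ x, a ≤ x → x ≤ a + h → |v x - (A + B * (x - a))| ≤ M) :
    |∫ x in a..a + h, ((v a + v (a + h)) / 2 - v x)| ≤ 2 * M * h := by
  -- The trapezoidal rule is exact on affine functions, so the affine part may be subtracted.
  have haff : ∫ x in a..a + h, (B * (h / 2) - B * (x - a)) = 0 := by
    rw [intervalIntegral.integral_sub (by simp) (Continuous.intervalIntegrable (by fun_prop) _ _),
      intervalIntegral.integral_const, intervalIntegral.integral_const_mul,
      intervalIntegral.integral_comp_sub_right (fun z => z), integral_id]
    simp
    ring
  rw [← sub_zero (∫ x in a..a + h, ((v a + v (a + h)) / 2 - v x)), ← haff,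
    ← intervalIntegral.integral_sub]
  · refine abs_intervalIntegral_le hh fun x hx hx' => ?_
    have h0 := hM a le_rfl (by linarith)
    have h1 := hM (a + h) (by linarith) le_rfl
    have h2 := hM x hx hx'
    rw [abs_le] at *
    constructor <;> linarith [h0.1, h0.2, h1.1, h1.2, h2.1, h2.2]
  all_goals exact Continuous.intervalIntegrable (by fun_prop) _ _

/-- Straightening the lateral boundaries costs only O(h⁴): the substitution x = C(s), with C the
mean of `c` at the ends of the strip, brings both integrals to the same rectangle. There C − c and
C′ − c′ are O(h) pointwise but have τ-integrals of order h³. -/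
theorem exists_abs_trapezoid_curve_le {g c c' : ℝ × ℝ → ℝ} (hg : ∀ z, C11At g z)
    (hc : ∀ z, C11At c z) (hc' : ∀ z, C11At c' z)
    (hcc' : ∀ s τ, HasDerivAt (fun s => c (s, τ)) (c' (s, τ)) s) (R : ℝ) :
    ∃ K : ℝ, 0 ≤ K ∧ ∀ h, 0 < h → h ≤ 1 → ∀ s₀ τ₀ : ℝ, |s₀| ≤ R → |τ₀| ≤ R →
      |(∫ x in (c (s₀, τ₀) + c (s₀, τ₀ + h)) / 2..(c (s₀ + h, τ₀) + c (s₀ + h, τ₀ + h)) / 2,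
          ∫ τ in τ₀..τ₀ + h, g (x, τ))
        - ∫ τ in τ₀..τ₀ + h, ∫ s in s₀..s₀ + h, g (c (s, τ), τ) * c' (s, τ)| ≤ K * h ^ 4 := by
  have hgc := c11_continuous hg
  have hcc := c11_continuous hc
  have hcc'' := c11_continuous hc'
  obtain ⟨K₁, hK₁⟩ := exists_c11Bound hc (R + 1)
  obtain ⟨K₂, hK₂⟩ := exists_c11Bound hc' (R + 1)
  -- The arguments of `g` are pairs (value of `c` or its mean, τ), bounded by `K₁` and `R + 1`.
  obtain ⟨K₃, hK₃⟩ := exists_c11Bound hg (max (R + 1) K₁)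
  set K := max (max K₁ K₂) K₃
  have hC : C11Bound c (R + 1) K :=
    hK₁.mono le_rfl ((le_max_left _ _).trans (le_max_left _ _))
  have hC' : C11Bound c' (R + 1) K :=
    hK₂.mono le_rfl ((le_max_right _ _).trans (le_max_left _ _))
  have hG : C11Bound g (max (R + 1) K₁) K := hK₃.mono le_rfl (le_max_right _ _)
  have hK0 := hC.nonneg
  refine ⟨2 * K ^ 3 + 2 * K ^ 2 + (K ^ 3 + K ^ 2) * K + (K * (K + 1)) * K, by positivity, ?_⟩
  intro h hh hh1 s₀ τ₀ hs₀ hτ₀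
  set C : ℝ → ℝ := fun s => (c (s, τ₀) + c (s, τ₀ + h)) / 2 with hCdef
  set C' : ℝ → ℝ := fun s => (c' (s, τ₀) + c' (s, τ₀ + h)) / 2 with hC'def
  have hCcont : Continuous C := by fun_prop
  have hC'cont : Continuous C' := by fun_prop
  have hCd : ∀ s, HasDerivAt C (C' s) s := fun s => ((hcc' s τ₀).add (hcc' s (τ₀ + h))).div_const 2
  have e1 : (∫ x in C s₀..C (s₀ + h), ∫ τ in τ₀..τ₀ + h, g (x, τ))
      = ∫ s in s₀..s₀ + h, ∫ τ in τ₀..τ₀ + h, g (C s, τ) * C' s := by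
    rw [← intervalIntegral.integral_comp_mul_deriv (fun s _ => hCd s) hC'cont.continuousOn
      (continuous_integral_snd hgc _ _)]
    simp only [Function.comp, intervalIntegral.integral_mul_const]
  have e2 : (∫ τ in τ₀..τ₀ + h, ∫ s in s₀..s₀ + h, g (c (s, τ), τ) * c' (s, τ))
      = ∫ s in s₀..s₀ + h, ∫ τ in τ₀..τ₀ + h, g (c (s, τ), τ) * c' (s, τ) :=
    (integral_swap_of_continuous (G := fun z => g (c z, z.2) * c' z) (by fun_prop) _ _ _ _).symm
  change |(∫ x in C s₀..C (s₀ + h), ∫ τ in τ₀..τ₀ + h, g (x, τ)) - _| ≤ _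
  rw [e1, e2, ← intervalIntegral.integral_sub
    ((continuous_integral_snd (G := fun z => g (C z.1, z.2) * C' z.1)
      (by fun_prop) _ _).intervalIntegrable _ _)
    ((continuous_integral_snd (G := fun z => g (c z, z.2) * c' z)
      (by fun_prop) _ _).intervalIntegrable _ _)]
  refine (abs_intervalIntegral_le (C := (2 * K ^ 3 + 2 * K ^ 2 + (K ^ 3 + K ^ 2) * K + (K * (K + 1)) * K)
    * h ^ 3) hh.le fun s hs hs' => ?_).trans_eq (by ring)
  have hsR : |s| ≤ R + 1 := by
    rw [abs_le] at *; constructor <;> linarith [hs₀.1, hs₀.2]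
  have hτR : ∀ τ, τ₀ ≤ τ → τ ≤ τ₀ + h → |τ| ≤ R + 1 := fun τ h1 h2 => by
    rw [abs_le] at *; constructor <;> linarith [hτ₀.1, hτ₀.2]
  have hmem : ∀ τ, τ₀ ≤ τ → τ ≤ τ₀ + h → ‖((s, τ) : ℝ × ℝ)‖ ≤ R + 1 := fun τ h1 h2 =>
    norm_mk_le hsR (hτR τ h1 h2)
  have h0 := hmem τ₀ le_rfl (by linarith)
  have h1 := hmem (τ₀ + h) (by linarith) le_rfl
  have hvar : ∀ {u : ℝ × ℝ → ℝ}, C11Bound u (R + 1) K → ∀ τ, τ₀ ≤ τ → τ ≤ τ₀ + h →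
      |(u (s, τ₀) + u (s, τ₀ + h)) / 2 - u (s, τ)| ≤ K * h := by
    intro u hu τ h2 h3
    have a1 := hu.abs_sub_le _ _ (hmem τ h2 h3) h0
    have a2 := hu.abs_sub_le _ _ (hmem τ h2 h3) h1
    rw [Prod.mk_sub_mk, sub_self, Prod.norm_mk, norm_zero, Real.norm_eq_abs,
      max_eq_right (abs_nonneg _)] at a1 a2
    have b1 : K * |τ₀ - τ| ≤ K * h := by
      gcongr; rw [abs_le]; constructor <;> linarith
    have b2 : K * |τ₀ + h - τ| ≤ K * h := by
      gcongr; rw [abs_le]; constructor <;> linarith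
    rw [abs_le] at *
    constructor <;> linarith [a1.1, a1.2, a2.1, a2.2]
  have htrap : ∀ {u : ℝ × ℝ → ℝ}, Continuous u → C11Bound u (R + 1) K →
      |∫ τ in τ₀..τ₀ + h, ((u (s, τ₀) + u (s, τ₀ + h)) / 2 - u (s, τ))| ≤ 2 * (K * h ^ 2) * h := by
    intro u huc hu
    refine abs_integral_trapezoid_le (v := fun τ => u (s, τ)) (by fun_prop) hh.le
      (A := u (s, τ₀)) (B := fderiv ℝ u (s, τ₀) (0, 1)) fun τ h2 h3 => ?_
    have := hu.taylor _ _ h0 (hmem τ h2 h3)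
    rw [Prod.mk_sub_mk, sub_self, Prod.norm_mk, norm_zero, Real.norm_eq_abs,
      max_eq_right (abs_nonneg _), apply_snd_eq] at this
    rw [← sub_sub]
    refine this.trans ?_
    gcongr
    rw [abs_le]; constructor <;> linarith
  have hcK : ∀ τ, τ₀ ≤ τ → τ ≤ τ₀ + h → |c (s, τ)| ≤ max (R + 1) K₁ := fun τ h2 h3 =>
    (hK₁.abs_le _ (hmem τ h2 h3)).trans (le_max_right _ _)
  have hCK : |C s| ≤ max (R + 1) K₁ := by
    have a1 := hcK τ₀ le_rfl (by linarith)
    have a2 := hcK (τ₀ + h) (by linarith) le_rfl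
    simp only [hCdef]
    rw [abs_le] at *
    constructor <;> linarith [a1.1, a1.2, a2.1, a2.2]
  have hC'K : |C' s| ≤ K := by
    have a1 := hC'.abs_le _ h0
    have a2 := hC'.abs_le _ h1
    simp only [hC'def]
    rw [abs_le] at *
    constructor <;> linarith [a1.1, a1.2, a2.1, a2.2]
  have hτm : ∀ τ, τ₀ ≤ τ → τ ≤ τ₀ + h → |τ| ≤ max (R + 1) K₁ := fun τ h2 h3 =>
    (hτR τ h2 h3).trans (le_max_left _ _)
  have hz0 : ‖((C s, τ₀) : ℝ × ℝ)‖ ≤ max (R + 1) K₁ :=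
    norm_mk_le hCK (hτm τ₀ le_rfl (by linarith))
  -- Coefficients frozen at `τ₀` leave the τ-integral, so the trapezoidal estimate applies to the
  -- terms linear in C − c and C′ − c′.
  set α := fderiv ℝ g (C s, τ₀) (1, 0) with hα
  set γ := g (C s, τ₀) with hγ
  have hαK : |α| ≤ K := abs_apply_le (hG.fderiv_le _ hz0)
  have hγK : |γ| ≤ K := hG.abs_le _ hz0
  -- What freezing leaves over is a Taylor remainder or a product of two O(h) factors, hence O(h²)
  -- pointwise.
  have hrest : ∀ τ, τ₀ ≤ τ → τ ≤ τ₀ + h →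
      |(g (C s, τ) - g (c (s, τ), τ) - α * (C s - c (s, τ))) * C' s
        + (g (c (s, τ), τ) - γ) * (C' s - c' (s, τ))|
      ≤ ((K ^ 3 + K ^ 2) * K + (K * (K + 1)) * K) * h ^ 2 := by
    intro τ h2 h3
    have hz : ‖((C s, τ) : ℝ × ℝ)‖ ≤ max (R + 1) K₁ := norm_mk_le hCK (hτm τ h2 h3)
    have hw : ‖((c (s, τ), τ) : ℝ × ℝ)‖ ≤ max (R + 1) K₁ := norm_mk_le (hcK τ h2 h3) (hτm τ h2 h3)
    have hδ : |C s - c (s, τ)| ≤ K * h := hvar hC τ h2 h3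
    have hδ' : |C' s - c' (s, τ)| ≤ K * h := hvar hC' τ h2 h3
    have hτh : |τ - τ₀| ≤ h := by rw [abs_le]; constructor <;> linarith
    have t1 := hG.taylor _ _ hz hw
    rw [Prod.mk_sub_mk, sub_self, apply_fst_eq, Prod.norm_mk, norm_zero, Real.norm_eq_abs,
      max_eq_left (abs_nonneg _), abs_sub_comm (c (s, τ))] at t1
    have t1' : K * |C s - c (s, τ)| ^ 2 ≤ K * (K * h) ^ 2 := by gcongr
    have t2 : |fderiv ℝ g (C s, τ) (1, 0) - α| ≤ K * h := by
      have := hG.fderiv_sub_le _ _ hz0 hz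
      rw [Prod.mk_sub_mk, sub_self, Prod.norm_mk, norm_zero, Real.norm_eq_abs,
        max_eq_right (abs_nonneg _)] at this
      rw [hα, ← sub_apply]
      exact abs_apply_le (this.trans (by gcongr))
    have t3 : |(fderiv ℝ g (C s, τ) (1, 0) - α) * (C s - c (s, τ))| ≤ K * h * (K * h) := by
      rw [abs_mul]; gcongr
    have t4 : |g (C s, τ) - g (c (s, τ), τ) - α * (C s - c (s, τ))| ≤ (K ^ 3 + K ^ 2) * h ^ 2 := by
      rw [abs_le] at *
      constructor <;> linarith [t1.1, t1.2, t3.1, t3.2]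
    have t5 : |g (c (s, τ), τ) - γ| ≤ K * ((K + 1) * h) := by
      refine (hG.abs_sub_le _ _ hz0 hw).trans ?_
      gcongr
      rw [Prod.mk_sub_mk]
      refine norm_mk_le ?_ (hτh.trans (by nlinarith))
      rw [abs_sub_comm]
      exact hδ.trans (by nlinarith)
    refine (abs_add_le _ _).trans ?_
    rw [abs_mul, abs_mul]
    calc _ ≤ (K ^ 3 + K ^ 2) * h ^ 2 * K + K * ((K + 1) * h) * (K * h) := by gcongr
      _ = _ := by ring
  have hsplit : (∫ τ in τ₀..τ₀ + h, g (C s, τ) * C' s)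
        - ∫ τ in τ₀..τ₀ + h, g (c (s, τ), τ) * c' (s, τ)
      = α * C' s * (∫ τ in τ₀..τ₀ + h, (C s - c (s, τ)))
        + γ * (∫ τ in τ₀..τ₀ + h, (C' s - c' (s, τ)))
        + ∫ τ in τ₀..τ₀ + h, ((g (C s, τ) - g (c (s, τ), τ) - α * (C s - c (s, τ))) * C' s
        + (g (c (s, τ), τ) - γ) * (C' s - c' (s, τ))) := by
    rw [← intervalIntegral.integral_const_mul, ← intervalIntegral.integral_const_mul,
      ← intervalIntegral.integral_sub, ← intervalIntegral.integral_add,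
      ← intervalIntegral.integral_add]
    · congr 1
      ext τ
      ring
    all_goals exact Continuous.intervalIntegrable (by fun_prop) _ _
  have i1 : |α * C' s * ∫ τ in τ₀..τ₀ + h, (C s - c (s, τ))| ≤ K * K * (2 * (K * h ^ 2) * h) := by
    rw [abs_mul, abs_mul]
    gcongr
    exact htrap hcc hC
  have i2 : |γ * ∫ τ in τ₀..τ₀ + h, (C' s - c' (s, τ))| ≤ K * (2 * (K * h ^ 2) * h) := by
    rw [abs_mul]
    gcongr
    exact htrap hcc'' hC'
  have i3 := abs_intervalIntegral_le hh.le hrest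
  rw [hsplit]
  refine (abs_add_three _ _ _).trans ?_
  linarith

/-- One sweep of the cascade: reconstruction of the masses of a strip between faces that are the
means of the end points of the curves `τ ↦ c (s, τ)`. -/
theorem exists_abs_cascade_sweep_le {d : ℕ} (hd : 1 ≤ d) {g c c' : ℝ × ℝ → ℝ}
    (hg : ∀ z, C11At g z) (hc : ∀ z, C11At c z) (hc' : ∀ z, C11At c' z)
    (hcc' : ∀ s τ, HasDerivAt (fun s => c (s, τ)) (c' (s, τ)) s) (R : ℝ) :
    ∃ K : ℝ, 0 ≤ K ∧ ∀ h, 0 < h → h ≤ 1 → ∀ (o s₀ τ₀ : ℝ) (xs u : ℤ → ℝ) (i : ℤ),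
      |s₀| ≤ R → |τ₀| ≤ R → xs i = (c (s₀, τ₀) + c (s₀, τ₀ + h)) / 2 →
      xs (i + 1) = (c (s₀ + h, τ₀) + c (s₀ + h, τ₀ + h)) / 2 →
      (∀ c, h * u c = ∫ y in face o h c..face o h (c + 1), ∫ τ in τ₀..τ₀ + h, g (y, τ)) →
      |reconstruct d o h xs u i
        - ∫ τ in τ₀..τ₀ + h, ∫ s in s₀..s₀ + h, g (c (s, τ), τ) * c' (s, τ)| ≤ K * h ^ 4 := by
  obtain ⟨K₁, hK₁⟩ := exists_c11Bound hc (R + 1)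
  obtain ⟨K₂, hK₂0, hK₂⟩ := exists_abs_reconstruct_strip_le hd hg (max R K₁)
  obtain ⟨K₃, hK₃0, hK₃⟩ := exists_abs_trapezoid_curve_le hg hc hc' hcc' R
  refine ⟨K₂ + K₃, by positivity, fun h hh hh1 o s₀ τ₀ xs u i hs₀ hτ₀ hx hx' hu => ?_⟩
  have hplus : ∀ {r : ℝ}, |r| ≤ R → |r| ≤ R + 1 ∧ |r + h| ≤ R + 1 := fun hr => by
    rw [abs_le, abs_le] at *
    refine ⟨⟨?_, ?_⟩, ?_, ?_⟩ <;> linarith [hr.1, hr.2]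
  have hmean : ∀ a b : ℝ, |a| ≤ K₁ → |b| ≤ K₁ → |(a + b) / 2| ≤ max R K₁ := fun a b ha hb => by
    refine le_max_of_le_right ?_
    rw [abs_le] at *
    constructor <;> linarith [ha.1, ha.2, hb.1, hb.2]
  have hb : ∀ s τ, |s| ≤ R + 1 → |τ| ≤ R + 1 → |c (s, τ)| ≤ K₁ := fun s τ hs hτ =>
    hK₁.abs_le _ (norm_mk_le hs hτ)
  have e1 := hK₂ h hh hh1 o τ₀ xs u i (hτ₀.trans (le_max_left _ _))
    (hx ▸ hmean _ _ (hb _ _ (hplus hs₀).1 (hplus hτ₀).1) (hb _ _ (hplus hs₀).1 (hplus hτ₀).2))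
    (hx' ▸ hmean _ _ (hb _ _ (hplus hs₀).2 (hplus hτ₀).1) (hb _ _ (hplus hs₀).2 (hplus hτ₀).2)) hu
  have e2 := hK₃ h hh hh1 s₀ τ₀ hs₀ hτ₀
  rw [hx, hx'] at e1
  rw [abs_le] at *
  constructor <;> linarith [e1.1, e1.2, e2.1, e2.2]

end CCSL

/-! ### Characteristics: constancy of the solution and preservation of area. -/

namespace CCSL

open Set

theorem uniqueDiffOn_Icc_prod_univ {t₀ t₁ : ℝ} (ht : t₀ < t₁) :
    UniqueDiffOn ℝ (Icc t₀ t₁ ×ˢ (univ : Set (ℝ × ℝ))) :=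
  (uniqueDiffOn_Icc ht).prod uniqueDiffOn_univ

section

variable {E : Type*} [NormedAddCommGroup E] [NormedSpace ℝ E] {t₀ t₁ : ℝ}

/-- Slices of a function that is smooth on `[t₀, t₁] × ℝ²`. -/
theorem contDiff_slice {n : WithTop ℕ∞} {u : ℝ × (ℝ × ℝ) → E}
    (hu : ContDiffOn ℝ n u (Icc t₀ t₁ ×ˢ univ)) {t : ℝ} (ht : t ∈ Icc t₀ t₁) :
    ContDiff ℝ n fun z => u (t, z) := by
  rw [← contDiffOn_univ]
  exact hu.comp (f := fun z => (t, z)) (contDiff_const.prodMk contDiff_id).contDiffOn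
    fun z _ => ⟨ht, mem_univ _⟩

theorem hasFDerivAt_slice {u : ℝ × (ℝ × ℝ) → E} {t : ℝ} (ht : t ∈ Icc t₀ t₁) {z : ℝ × ℝ}
    {L : ℝ × (ℝ × ℝ) →L[ℝ] E} (hu : HasFDerivWithinAt u L (Icc t₀ t₁ ×ˢ univ) (t, z)) :
    HasFDerivAt (fun w => u (t, w)) (L.comp (ContinuousLinearMap.inr ℝ ℝ (ℝ × ℝ))) z := by
  rw [← hasFDerivWithinAt_univ]
  exact hu.comp (f := fun w => (t, w)) z (hasFDerivAt_prodMk_right t z).hasFDerivWithinAt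
    fun w _ => ⟨ht, mem_univ _⟩

theorem hasDerivWithinAt_comp_curve {u : ℝ × (ℝ × ℝ) → E} {t : ℝ}
    {Y : ℝ → ℝ × ℝ} {Y' : ℝ × ℝ} {L : ℝ × (ℝ × ℝ) →L[ℝ] E}
    (hu : HasFDerivWithinAt u L (Icc t₀ t₁ ×ˢ univ) (t, Y t))
    (hY : HasDerivWithinAt Y Y' (Icc t₀ t₁) t) :
    HasDerivWithinAt (fun τ => u (τ, Y τ)) (L (1, Y')) (Icc t₀ t₁) t :=
  HasFDerivWithinAt.comp_hasDerivWithinAt (f := fun τ => (τ, Y τ)) t hu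
    ((hasDerivWithinAt_id t _).prodMk hY) fun _ hτ => ⟨hτ, mem_univ _⟩

end

theorem eq_of_hasDerivWithinAt_zero {t₀ t₁ : ℝ} {J : ℝ → ℝ}
    (hJ : ∀ t ∈ Icc t₀ t₁, HasDerivWithinAt J 0 (Icc t₀ t₁) t) {t : ℝ} (ht : t ∈ Icc t₀ t₁) :
    J t = J t₀ := by
  refine constant_of_derivWithin_zero (fun s hs => (hJ s hs).differentiableWithinAt)
    (fun s hs => ?_) t ht
  have hs' := Ico_subset_Icc_self hs
  exact (hJ s hs').derivWithin (uniqueDiffOn_Icc (hs.1.trans_lt hs.2) s hs')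

theorem clm_apply_eq (A : ℝ × ℝ →L[ℝ] ℝ × ℝ) (v : ℝ × ℝ) :
    A v = v.1 • A (1, 0) + v.2 • A (0, 1) := by
  rw [← map_smul, ← map_smul, ← map_add]
  congr 1
  ext <;> simp

theorem div_smul_eq {v : ℝ × ℝ → ℝ × ℝ} {r : ℝ × ℝ → ℝ} {z : ℝ × ℝ} (hv : DifferentiableAt ℝ v z)
    (hr : DifferentiableAt ℝ r z) :
    div (fun w => r w • v w) z = r z * div v z + fderiv ℝ r z (v z) := by
  have hL : fderiv ℝ r z (v z) = (v z).1 * fderiv ℝ r z (1, 0) + (v z).2 * fderiv ℝ r z (0, 1) := by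
    rw [← smul_eq_mul, ← smul_eq_mul, ← map_smul, ← map_smul, ← map_add]
    congr 1
    ext <;> simp
  rw [div, div, (hr.hasFDerivAt.fun_smul hv.hasFDerivAt).fderiv, hL]
  simp
  ring

variable {t₀ t₁ : ℝ} {a : ℝ → ℝ × ℝ → ℝ × ℝ} {X : ℝ → ℝ → ℝ × ℝ → ℝ × ℝ}

/-- A solution of the transport equation is constant along the characteristics. -/
theorem solution_eq_along_characteristic (ht : t₀ < t₁)
    (ha : ContDiffOn ℝ 1 (Function.uncurry a) (Icc t₀ t₁ ×ˢ univ))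
    (hdiv : ∀ t ∈ Icc t₀ t₁, ∀ z : ℝ × ℝ, div (a t) z = 0)
    (hX : IsCharacteristicFlow a X t₀ t₁)
    {f : ℝ → ℝ × ℝ → ℝ}
    (hf : ContDiffOn ℝ 2 (Function.uncurry f) (Icc t₀ t₁ ×ˢ univ))
    (hfsol : SolvesTransport a f t₀ t₁) (z : ℝ × ℝ) : f t₁ z = f t₀ (X t₀ t₁ z) := by
  have h1 : t₁ ∈ Icc t₀ t₁ := right_mem_Icc.2 ht.le
  obtain ⟨hid, hchar⟩ := hX t₁ h1 z
  have key : ∀ t ∈ Icc t₀ t₁,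
      HasDerivWithinAt (fun τ => f τ (X τ t₁ z)) 0 (Icc t₀ t₁) t := by
    intro t htt
    set w := X t t₁ z with hw
    have hfd := (hf.differentiableOn (by norm_num) (t, w) ⟨htt, mem_univ _⟩).hasFDerivWithinAt
    set L := fderivWithin ℝ (Function.uncurry f) (Icc t₀ t₁ ×ˢ univ) (t, w)
    have hmain := hasDerivWithinAt_comp_curve (Y := fun τ => X τ t₁ z) hfd (hchar t htt)
    have htime := hasDerivWithinAt_comp_curve (Y := fun _ => w) hfd (hasDerivWithinAt_const t _ w)
    have hspace := hasFDerivAt_slice htt hfd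
    have e1 : derivWithin (fun τ => f τ w) (Icc t₀ t₁) t = L (1, 0) :=
      htime.derivWithin (uniqueDiffOn_Icc ht t htt)
    have e2 : fderiv ℝ (f t) w (a t w) = L (0, a t w) := by
      rw [show fderiv ℝ (f t) w = _ from hspace.fderiv]
      simp
    have heq := hfsol t htt w
    have hdv := div_smul_eq (v := a t) (r := f t)
      ((contDiff_slice ha htt).differentiable (by norm_num) w) hspace.differentiableAt
    -- The material derivative ∂ₜf + a · ∇f: it equals ∂ₜf + div(a f) because div a = 0.
    have e4 : L (1, a t w) = 0 := by
      rw [show ((1, a t w) : ℝ × (ℝ × ℝ)) = (1, 0) + (0, a t w) by simp, map_add]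
      rwa [e1, hdv, hdiv t htt w, mul_zero, zero_add, e2] at heq
    rw [← hw, e4] at hmain
    exact hmain
  have := eq_of_hasDerivWithinAt_zero key h1
  rwa [hid] at this

/-- Liouville's theorem: the flow of a divergence-free field preserves areas. -/
theorem det_fderiv_backtracking_eq_one (ht : t₀ < t₁)
    (ha : ContDiffOn ℝ 1 (Function.uncurry a) (Icc t₀ t₁ ×ˢ univ))
    (hdiv : ∀ t ∈ Icc t₀ t₁, ∀ z : ℝ × ℝ, div (a t) z = 0)
    (hX : IsCharacteristicFlow a X t₀ t₁)
    (hXsmooth : ContDiffOn ℝ 2 (fun w : ℝ × (ℝ × ℝ) => X w.1 t₁ w.2) (Icc t₀ t₁ ×ˢ univ))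
    (z : ℝ × ℝ) :
    (fderiv ℝ (X t₀ t₁) z (1, 0)).1 * (fderiv ℝ (X t₀ t₁) z (0, 1)).2
      - (fderiv ℝ (X t₀ t₁) z (1, 0)).2 * (fderiv ℝ (X t₀ t₁) z (0, 1)).1 = 1 := by
  have h1 : t₁ ∈ Icc t₀ t₁ := right_mem_Icc.2 ht.le
  set S := Icc t₀ t₁ ×ˢ (univ : Set (ℝ × ℝ)) with hS
  have hSu : UniqueDiffOn ℝ S := uniqueDiffOn_Icc_prod_univ ht
  set u : ℝ × (ℝ × ℝ) → ℝ × ℝ := fun w => X w.1 t₁ w.2 with hu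
  have hu1 : ContDiffOn ℝ 1 (fderivWithin ℝ u S) S := hXsmooth.fderivWithin hSu (by norm_num)
  have hud : ∀ t ∈ Icc t₀ t₁, ∀ w, HasFDerivWithinAt u (fderivWithin ℝ u S (t, w)) S (t, w) :=
    fun t h w => (hXsmooth.differentiableOn (by norm_num) (t, w) ⟨h, mem_univ _⟩).hasFDerivWithinAt
  have hspace : ∀ t ∈ Icc t₀ t₁, ∀ w e, fderiv ℝ (X t t₁) w e = fderivWithin ℝ u S (t, w) (0, e) := by
    intro t h w e
    rw [show fderiv ℝ (X t t₁) w = _ from (hasFDerivAt_slice h (hud t h w)).fderiv]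
    simp
  have htime : ∀ t ∈ Icc t₀ t₁, ∀ w, fderivWithin ℝ u S (t, w) (1, 0) = a t (X t t₁ w) := by
    intro t h w
    have e1 := hasDerivWithinAt_comp_curve (Y := fun _ => w) (hud t h w)
      (hasDerivWithinAt_const t _ w)
    exact (uniqueDiffOn_Icc ht t h).eq_deriv _ e1 ((hX t₁ h1 w).2 t h)
  -- The variational equation ∂ₜ(∂ₑX) = Da(X) ∂ₑX, obtained by exchanging the time and space
  -- derivatives of X.
  have hV : ∀ e, ∀ t ∈ Icc t₀ t₁, HasDerivWithinAt (fun τ => fderivWithin ℝ u S (τ, z) (0, e))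
      (fderiv ℝ (a t) (X t t₁ z) (fderivWithin ℝ u S (t, z) (0, e))) (Icc t₀ t₁) t := by
    intro e t h
    have hmem : (t, z) ∈ S := ⟨h, mem_univ _⟩
    have hD := (hu1.differentiableOn (by norm_num) (t, z) hmem).hasFDerivWithinAt
    set D := fderivWithin ℝ (fderivWithin ℝ u S) S (t, z)
    have hcurve := hasDerivWithinAt_comp_curve (Y := fun _ => z) hD (hasDerivWithinAt_const t _ z)
    have h2 := hcurve.clm_apply (hasDerivWithinAt_const t _ ((0, e) : ℝ × (ℝ × ℝ)))
    -- Second derivatives within the slab are symmetric also at the end times, since these lie in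
    -- the closure of its interior.
    have hsymm : D (1, 0) (0, e) = D (0, e) (1, 0) := by
      refine ((hXsmooth (t, z) hmem).isSymmSndFDerivWithinAt (by simp) hSu ?_ hmem) _ _
      rw [hS, interior_prod_eq, interior_univ, interior_Icc, closure_prod_eq, closure_univ,
        closure_Ioo ht.ne]
      exact hmem
    have h3 : HasFDerivAt (fun w => fderivWithin ℝ u S (t, w) (1, 0)) _ z :=
      (hasFDerivAt_slice h hD).clm_apply (hasFDerivAt_const ((1, 0) : ℝ × (ℝ × ℝ)) z)
    have h4 : HasFDerivAt (fun w => a t (X t t₁ w)) _ z :=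
      HasFDerivAt.comp (g := a t) (f := X t t₁) z
        ((contDiff_slice ha h).differentiable (by norm_num) (X t t₁ z)).hasFDerivAt
        (hasFDerivAt_slice h (hud t h z))
    have h5 := h3.unique (h4.congr_of_eventuallyEq (.of_forall fun w => htime t h w))
    have h6 := congrArg (fun L => L e) h5
    simp only [add_apply, ContinuousLinearMap.comp_apply,
      ContinuousLinearMap.inr_apply, ContinuousLinearMap.flip_apply] at h6
    rw [zero_apply, map_zero, zero_add, ← hsymm] at h6
    refine h2.congr_deriv ?_
    rw [map_zero, add_zero]
    exact h6
  set V := fun τ => fderivWithin ℝ u S (τ, z) (0, ((1, 0) : ℝ × ℝ)) with hVdef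
  set W := fun τ => fderivWithin ℝ u S (τ, z) (0, ((0, 1) : ℝ × ℝ)) with hWdef
  have hJ : ∀ t ∈ Icc t₀ t₁, HasDerivWithinAt
      (fun τ => (V τ).1 * (W τ).2 - (V τ).2 * (W τ).1) 0 (Icc t₀ t₁) t := by
    intro t h
    have hv := hV (1, 0) t h
    have hw := hV (0, 1) t h
    have hd := hdiv t h (X t t₁ z)
    rw [div] at hd
    rw [clm_apply_eq] at hv hw
    set A := fderiv ℝ (a t) (X t t₁ z)
    have hfst := fun {Y : ℝ → ℝ × ℝ} {Y' : ℝ × ℝ} (hY : HasDerivWithinAt Y Y' (Icc t₀ t₁) t) =>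
      (ContinuousLinearMap.fst ℝ ℝ ℝ).hasFDerivAt.comp_hasDerivWithinAt t hY
    have hsnd := fun {Y : ℝ → ℝ × ℝ} {Y' : ℝ × ℝ} (hY : HasDerivWithinAt Y Y' (Icc t₀ t₁) t) =>
      (ContinuousLinearMap.snd ℝ ℝ ℝ).hasFDerivAt.comp_hasDerivWithinAt t hY
    refine (((hfst hv).mul (hsnd hw)).sub ((hsnd hv).mul (hfst hw))).congr_deriv ?_
    simp only [Prod.fst_add, Prod.snd_add, Prod.smul_fst, Prod.smul_snd, smul_eq_mul,
      ContinuousLinearMap.coe_fst', ContinuousLinearMap.coe_snd', Function.comp]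
    -- The derivative of the Jacobian is div a times the Jacobian.
    linear_combination ((V t).1 * (W t).2 - (V t).2 * (W t).1) * hd
  have hend := eq_of_hasDerivWithinAt_zero hJ h1
  have h0 : t₀ ∈ Icc t₀ t₁ := left_mem_Icc.2 ht.le
  have hid : X t₁ t₁ = id := funext fun w => (hX t₁ h1 w).1
  rw [hspace t₀ h0, hspace t₀ h0]
  refine hend.symm.trans ?_
  simp only [hVdef, hWdef, ← hspace t₁ h1, hid, fderiv_id]
  simp

end CCSL

/-! ### Combination of the two sweeps. -/

namespace CCSL

open MeasureTheory

/-- The product is nested because the scheme feeds `h * favg` to the reconstruction, which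
multiplies by `h` once more. -/
theorem mul_mul_cellAverage {g : ℝ × ℝ → ℝ} (hg : Continuous g) (ox oy : ℝ) {h : ℝ} (hh : 0 < h)
    (i j : ℤ) : h * (h * cellAverage ox oy h g i j)
      = ∫ y in face oy h j..face oy h j + h, ∫ x in face ox h i..face ox h i + h, g (x, y) := by
  have hint : ∫ z in cell ox oy h i j, g z
      = ∫ x in face ox h i..face ox h i + h, ∫ y in face oy h j..face oy h j + h, g (x, y) := by
    rw [cell, Measure.volume_eq_prod, setIntegral_prod]
    · rw [intervalIntegral.integral_of_le (by linarith), face_add_one, face_add_one,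
        integral_Icc_eq_integral_Ioc]
      refine setIntegral_congr_fun measurableSet_Ioc fun x _ => ?_
      rw [intervalIntegral.integral_of_le (by linarith), integral_Icc_eq_integral_Ioc]
    · exact hg.continuousOn.integrableOn_compact (isCompact_Icc.prod isCompact_Icc)
  rw [cellAverage, hint, integral_swap_of_continuous hg]
  field_simp

/-- The backtracked image of the line `y = ξ` is the graph of `p(·, ξ)`. -/
theorem pCurve_apply {Φ : ℝ × ℝ → ℝ × ℝ} (hΦ : ∀ ξ : ℝ, Function.Bijective (xTrace Φ ξ))
    (w : ℝ × ℝ) : pCurve Φ ((Φ w).1, w.2) = (Φ w).2 := by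
  have : Function.invFun (xTrace Φ w.2) (Φ w).1 = w.1 :=
    Function.leftInverse_invFun (hΦ w.2).injective w.1
  simp [pCurve, this]

/-- For an area-preserving backtracking map, `∂p/∂ξ` is the reciprocal of `∂Φ₁/∂η`. -/
theorem fderiv_fst_mul_fderiv_pCurve {Φ : ℝ × ℝ → ℝ × ℝ}
    (hΦ : ∀ ξ : ℝ, Function.Bijective (xTrace Φ ξ)) {w : ℝ × ℝ} (hd : DifferentiableAt ℝ Φ w)
    (hp : DifferentiableAt ℝ (pCurve Φ) ((Φ w).1, w.2))
    (hdet : (fderiv ℝ Φ w (1, 0)).1 * (fderiv ℝ Φ w (0, 1)).2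
      - (fderiv ℝ Φ w (1, 0)).2 * (fderiv ℝ Φ w (0, 1)).1 = 1) :
    (fderiv ℝ Φ w (1, 0)).1 * fderiv ℝ (pCurve Φ) ((Φ w).1, w.2) (0, 1) = 1 := by
  set P := fderiv ℝ (pCurve Φ) ((Φ w).1, w.2)
  set D := fderiv ℝ Φ w
  have h1 : HasFDerivAt (fun w => pCurve Φ ((Φ w).1, w.2))
      (P.comp (((ContinuousLinearMap.fst ℝ ℝ ℝ).comp D).prod (ContinuousLinearMap.snd ℝ ℝ ℝ))) w :=
    HasFDerivAt.comp (g := pCurve Φ) (f := fun w : ℝ × ℝ => ((Φ w).1, w.2)) w hp.hasFDerivAt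
      (hd.hasFDerivAt.fst.prodMk hasFDerivAt_snd)
  have h2 : HasFDerivAt (fun w => pCurve Φ ((Φ w).1, w.2))
      ((ContinuousLinearMap.snd ℝ ℝ ℝ).comp D) w :=
    hd.hasFDerivAt.snd.congr_of_eventuallyEq (.of_forall fun w => pCurve_apply hΦ w)
  have h3 := h1.unique h2
  have e1 : P ((D (1, 0)).1, 0) = (D (1, 0)).2 := by
    simpa using congrArg (fun L => L ((1, 0) : ℝ × ℝ)) h3
  have e2 : P ((D (0, 1)).1, 1) = (D (0, 1)).2 := by
    simpa using congrArg (fun L => L ((0, 1) : ℝ × ℝ)) h3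
  have e3 : P ((D (0, 1)).1, 1) = P (1, 0) * (D (0, 1)).1 + P (0, 1) := by
    rw [← apply_fst_eq, ← map_add]; simp
  rw [apply_fst_eq] at e1
  rw [← e2, ← e1, e3] at hdet
  -- Substituting the two chain-rule identities, the terms with `P (1, 0)` cancel in the
  -- determinant.
  linear_combination hdet

theorem hasDerivAt_fst_slice {E : Type*} [NormedAddCommGroup E] [NormedSpace ℝ E] {u : ℝ × ℝ → E}
    {s τ : ℝ} (hu : DifferentiableAt ℝ u (s, τ)) :
    HasDerivAt (fun s => u (s, τ)) (fderiv ℝ u (s, τ) (1, 0)) s :=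
  hu.hasFDerivAt.comp_hasDerivAt (f := fun s => (s, τ)) s
    ((hasDerivAt_id s).prodMk (hasDerivAt_const s τ))

theorem hasDerivAt_snd_slice {E : Type*} [NormedAddCommGroup E] [NormedSpace ℝ E] {u : ℝ × ℝ → E}
    {s τ : ℝ} (hu : DifferentiableAt ℝ u (s, τ)) :
    HasDerivAt (fun τ => u (s, τ)) (fderiv ℝ u (s, τ) (0, 1)) τ :=
  hu.hasFDerivAt.comp_hasDerivAt (f := fun τ => (s, τ)) τ
    ((hasDerivAt_const τ s).prodMk (hasDerivAt_id τ))

/-- Second-order consistency of the cascade update for an area-preserving backtracking map `Φ`. -/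
theorem exists_abs_cellAverage_sub_update_le {Φ : ℝ × ℝ → ℝ × ℝ} (hΦ : ContDiff ℝ 2 Φ)
    (hbij : ∀ ξ : ℝ, Function.Bijective (xTrace Φ ξ))
    (hdet : ∀ w, (fderiv ℝ Φ w (1, 0)).1 * (fderiv ℝ Φ w (0, 1)).2
      - (fderiv ℝ Φ w (1, 0)).2 * (fderiv ℝ Φ w (0, 1)).1 = 1)
    (hp : ContDiff ℝ 2 (pCurve Φ))
    (hp' : LocallyLipschitz (iteratedFDeriv ℝ 2 (pCurve Φ)))
    {f : ℝ × ℝ → ℝ} (hf : ContDiff ℝ 2 f) (ox oy : ℝ) {d : ℕ} (hd : 1 ≤ d) (R : ℝ) :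
    ∃ C : ℝ, 0 ≤ C ∧ ∀ h, 0 < h → h ≤ 1 → ∀ k l : ℤ, |face ox h k| ≤ R → |face oy h l| ≤ R →
      |cellAverage ox oy h (fun z => f (Φ z)) k l
        - update d ox oy h Φ (cellAverage ox oy h f) k l| ≤ C * h ^ 2 := by
  set p := pCurve Φ with hpdef
  set pξ : ℝ × ℝ → ℝ := fun z => fderiv ℝ p z (0, 1) with hpξ
  have hswap : ∀ z, C11At (Prod.swap : ℝ × ℝ → ℝ × ℝ) z := fun z =>
    (contDiff_snd.prodMk contDiff_fst).contDiffAt.c11At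
  have hfC : ∀ z, C11At f z := fun z => hf.contDiffAt.c11At
  have hpC : ∀ z, C11At p z := fun z => hp.contDiffAt.c11At
  have hpξC : ∀ z, C11At pξ z := fun z => c11At_fderiv_apply hp hp' _ z
  have hΦ1C : ∀ z, C11At (fun z => (Φ z).1) z := fun z => hΦ.fst.contDiffAt.c11At
  have hmul : ∀ w, (fderiv ℝ Φ w (1, 0)).1 * pξ ((Φ w).1, w.2) = 1 := fun w =>
    fderiv_fst_mul_fderiv_pCurve hbij (hΦ.differentiable (by norm_num) w)
      (hp.differentiable (by norm_num) _) (hdet w)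
  -- The mass density in the coordinates (x, ξ), where y = p(x, ξ).
  set g : ℝ × ℝ → ℝ := fun z => f (z.1, p z) * pξ z with hg
  have hgC : ∀ z, C11At g z := fun z =>
    C11At.mul (C11At.comp (u := fun z : ℝ × ℝ => (z.1, p z)) (hfC _)
      (contDiff_fst.contDiffAt.c11At.prodMk (hpC z))) (hpξC z)
  obtain ⟨KΦ, hKΦ⟩ := exists_c11Bound hΦ1C (R + 1)
  -- Coordinates are swapped because the first sweep runs along y. Its radius includes every column
  -- that the second sweep's stencils can reach.
  obtain ⟨K₁, hK₁0, hK₁⟩ := exists_abs_cascade_sweep_le hd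
    (g := fun z => f z.swap) (c := fun z => p z.swap) (c' := fun z => pξ z.swap)
    (fun z => C11At.comp (hfC _) (hswap z)) (fun z => C11At.comp (hpC _) (hswap z))
    (fun z => C11At.comp (hpξC _) (hswap z))
    (fun s τ => hasDerivAt_snd_slice (hp.differentiable (by norm_num) _)) (max R (KΦ + d + 1))
  -- As Φ is only C², ∂ₛΦ₁ is a priori only C¹; written as the reciprocal of ∂_ξ p it is seen to
  -- have a Lipschitz derivative.
  obtain ⟨K₂, hK₂0, hK₂⟩ := exists_abs_cascade_sweep_le hd
    (g := g) (c := fun z => (Φ z).1) (c' := fun z => (pξ ((Φ z).1, z.2))⁻¹) hgC hΦ1C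
    (fun z => C11At.inv (C11At.comp (u := fun z : ℝ × ℝ => ((Φ z).1, z.2)) (hpξC _)
      ((hΦ1C z).prodMk contDiff_snd.contDiffAt.c11At)) (right_ne_zero_of_mul_eq_one (hmul z)))
    (fun s τ => by
      rw [← eq_inv_of_mul_eq_one_left (hmul (s, τ))]
      exact (ContinuousLinearMap.fst ℝ ℝ ℝ).hasFDerivAt.comp_hasDerivAt s
        (hasDerivAt_fst_slice (hΦ.differentiable (by norm_num) _))) R
  have hL0 := lebesgueBound_nonneg d
  have hKΦ0 := hKΦ.nonneg
  refine ⟨K₂ + (2 * lebesgueBound d * (d + 1) + KΦ + 1) * K₁, by positivity, ?_⟩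
  intro h hh hh1 k l hk hl
  set xs : ℤ → ℝ := fun c => xBar ox oy h Φ c l with hxs
  set u : ℤ → ℝ := fun c => intermediateMass d ox oy h Φ (cellAverage ox oy h f) c l / h with hu
  -- Exact input of the second sweep, to be compared with the computed input `u`.
  set v : ℤ → ℝ := fun c => (∫ y in face ox h c..face ox h (c + 1),
    ∫ s in face oy h l..face oy h l + h, g (y, s)) / h with hv
  have hxk : xs k = ((Φ (face ox h k, face oy h l)).1
      + (Φ (face ox h k, face oy h l + h)).1) / 2 := by
    simp only [hxs, xBar, face_add_one]
  have hxk1 : xs (k + 1) = ((Φ (face ox h k + h, face oy h l)).1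
      + (Φ (face ox h k + h, face oy h l + h)).1) / 2 := by
    simp only [hxs, xBar, face_add_one]
  have hplus : ∀ {r : ℝ}, |r| ≤ R → |r| ≤ R + 1 ∧ |r + h| ≤ R + 1 := fun hr => by
    rw [abs_le, abs_le] at *
    refine ⟨⟨?_, ?_⟩, ?_, ?_⟩ <;> linarith [hr.1, hr.2]
  have hmean : ∀ a b K : ℝ, |a| ≤ K → |b| ≤ K → |(a + b) / 2| ≤ K := fun a b K ha hb => by
    rw [abs_le] at *
    constructor <;> linarith [ha.1, ha.2, hb.1, hb.2]
  have hΦb : ∀ s τ, |s| ≤ R + 1 → |τ| ≤ R + 1 → |(Φ (s, τ)).1| ≤ KΦ := fun s τ hs hτ =>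
    hKΦ.abs_le _ (norm_mk_le hs hτ)
  have hxkb : |xs k| ≤ KΦ := hxk ▸ hmean _ _ _ (hΦb _ _ (hplus hk).1 (hplus hl).1)
    (hΦb _ _ (hplus hk).1 (hplus hl).2)
  have hxk1b : |xs (k + 1)| ≤ KΦ := hxk1 ▸ hmean _ _ _ (hΦb _ _ (hplus hk).2 (hplus hl).1)
    (hΦb _ _ (hplus hk).2 (hplus hl).2)
  have hxdiff : |xs (k + 1) - xs k| ≤ KΦ * h := by
    have hs : ∀ τ, |τ| ≤ R + 1 →
        |(Φ (face ox h k + h, τ)).1 - (Φ (face ox h k, τ)).1| ≤ KΦ * h := fun τ hτ => by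
      have := hKΦ.abs_sub_le (face ox h k, τ) (face ox h k + h, τ) (norm_mk_le (hplus hk).1 hτ)
        (norm_mk_le (hplus hk).2 hτ)
      rwa [Prod.mk_sub_mk, sub_self, add_sub_cancel_left, Prod.norm_mk, norm_zero,
        Real.norm_eq_abs, max_eq_left (abs_nonneg _), abs_of_pos hh] at this
    rw [hxk, hxk1]
    convert hmean _ _ _ (hs _ (hplus hl).1) (hs _ (hplus hl).2) using 2
    ring
  have hstage1 : ∀ c, |face ox h c| ≤ KΦ + d + 1 → |h * (u c - v c)| ≤ K₁ * h ^ 4 := by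
    intro c hc
    have := hK₁ h hh hh1 oy (face oy h l) (face ox h c) (fun j => yBar ox oy h Φ c j)
      (fun j => h * cellAverage ox oy h f c j) l (hl.trans (le_max_left _ _))
      (hc.trans (le_max_right _ _)) (by simp [yBar, yTilde, face_add_one, hpdef])
      (by simp [yBar, yTilde, face_add_one, hpdef])
      (fun j => by simpa [face_add_one] using mul_mul_cellAverage hf.continuous ox oy hh c j)
    have e : h * (u c - v c) = intermediateMass d ox oy h Φ (cellAverage ox oy h f) c l
        - ∫ y in face ox h c..face ox h (c + 1),
          ∫ s in face oy h l..face oy h l + h, g (y, s) := by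
      simp only [hu, hv]
      field_simp
    rw [e, face_add_one]
    exact this
  have hstab : |reconstruct d ox h xs u k - reconstruct d ox h xs v k|
      ≤ (2 * lebesgueBound d * (d + 1) + KΦ + 1) * (K₁ * h ^ 4) := by
    rw [← reconstruct_sub]
    refine abs_reconstruct_le d hh (by positivity) hxdiff fun c h1 h2 => hstage1 c ?_
    have hd0 : (d : ℝ) * h ≤ d := mul_le_of_le_one_right (Nat.cast_nonneg d) hh1
    rw [abs_le] at hxkb hxk1b ⊢
    have h3 : -KΦ ≤ min (xs k) (xs (k + 1)) := le_min hxkb.1 hxk1b.1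
    have h4 : max (xs k) (xs (k + 1)) ≤ KΦ := max_le hxkb.2 hxk1b.2
    constructor <;> linarith
  have hstage2 := hK₂ h hh hh1 ox (face ox h k) (face oy h l) xs v k hk hl hxk hxk1
    (fun c => by simp only [hv]; field_simp)
  -- The factor ∂_ξ p in `g` cancels against the Jacobian of the second substitution.
  have hexact : (∫ τ in face oy h l..face oy h l + h, ∫ s in face ox h k..face ox h k + h,
      g ((Φ (s, τ)).1, τ) * (pξ ((Φ (s, τ)).1, τ))⁻¹)
      = h * (h * cellAverage ox oy h (fun z => f (Φ z)) k l) := by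
    rw [mul_mul_cellAverage (g := fun z => f (Φ z)) (hf.continuous.comp hΦ.continuous) ox oy hh]
    have : ∀ s τ, g ((Φ (s, τ)).1, τ) * (pξ ((Φ (s, τ)).1, τ))⁻¹ = f (Φ (s, τ)) := fun s τ => by
      have h1 := right_ne_zero_of_mul_eq_one (hmul (s, τ))
      have h2 : p ((Φ (s, τ)).1, τ) = (Φ (s, τ)).2 := pCurve_apply hbij (s, τ)
      simp only [hg, h2]
      rw [mul_assoc, mul_inv_cancel₀ h1, mul_one]
    simp only [this]
  rw [hexact] at hstage2
  have hupd : update d ox oy h Φ (cellAverage ox oy h f) k l = reconstruct d ox h xs u k / h ^ 2 :=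
    rfl
  have hfinal : |h * (h * cellAverage ox oy h (fun z => f (Φ z)) k l)
      - reconstruct d ox h xs u k|
      ≤ (K₂ + (2 * lebesgueBound d * (d + 1) + KΦ + 1) * K₁) * h ^ 4 := by
    rw [abs_le] at *
    constructor <;> linarith [hstab.1, hstab.2, hstage2.1, hstage2.2]
  rw [hupd]
  have hrew : cellAverage ox oy h (fun z => f (Φ z)) k l - reconstruct d ox h xs u k / h ^ 2
      = (h * (h * cellAverage ox oy h (fun z => f (Φ z)) k l) - reconstruct d ox h xs u k)
        / h ^ 2 := by
    field_simp
  rw [hrew, abs_div, abs_of_pos (by positivity : 0 < h ^ 2), div_le_iff₀ (by positivity)]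
  exact hfinal.trans_eq (by ring)

end CCSL

theorem mainTheorem1
    (t₀ t₁ : ℝ) (ht : t₀ < t₁)
    -- the divergence-free velocity field and its smooth characteristics
    (a : ℝ → ℝ × ℝ → ℝ × ℝ)
    (ha : ContDiffOn ℝ 1 (Function.uncurry a) (Set.Icc t₀ t₁ ×ˢ Set.univ))
    (hdiv : ∀ t ∈ Set.Icc t₀ t₁, ∀ z : ℝ × ℝ, CCSL.div (a t) z = 0)
    (X : ℝ → ℝ → ℝ × ℝ → ℝ × ℝ)
    (hX : CCSL.IsCharacteristicFlow a X t₀ t₁)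
    (hXsmooth : ∀ s ∈ Set.Icc t₀ t₁,
      ContDiffOn ℝ 2 (fun w : ℝ × (ℝ × ℝ) => X w.1 s w.2) (Set.Icc t₀ t₁ ×ˢ Set.univ))
    -- the solution
    (f : ℝ → ℝ × ℝ → ℝ)
    (hf : ContDiffOn ℝ 2 (Function.uncurry f) (Set.Icc t₀ t₁ ×ˢ Set.univ))
    (hfsol : CCSL.SolvesTransport a f t₀ t₁)
    -- the backtracked grid lines are the graphs of `p` and `q`
    (hXinv : ∀ ξ : ℝ, Function.Bijective (CCSL.xTrace (X t₀ t₁) ξ))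
    (hYinv : ∀ η : ℝ, Function.Bijective (CCSL.yTrace (X t₀ t₁) η))
    (hp : ContDiff ℝ 2 (CCSL.pCurve (X t₀ t₁)))
    (hp' : LocallyLipschitz (iteratedFDeriv ℝ 2 (CCSL.pCurve (X t₀ t₁))))
    (hq : ContDiff ℝ 2 (CCSL.qCurve (X t₀ t₁)))
    (hq' : LocallyLipschitz (iteratedFDeriv ℝ 2 (CCSL.qCurve (X t₀ t₁))))
    -- the computational domain and the interpolation degree `2d + 1 ≥ 3`
    (xmin xmax ymin ymax : ℝ) (hx : xmin < xmax) (hy : ymin < ymax)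
    (d : ℕ) (hd : 1 ≤ d) :
    ∃ C h₀ : ℝ, 0 < C ∧ 0 < h₀ ∧
      ∀ h : ℝ, 0 < h → h ≤ h₀ →
      ∀ favg : ℤ → ℤ → ℝ,
        (∀ i j : ℤ, favg i j = CCSL.cellAverage xmin ymin h (f t₀) i j) →
      ∀ k l : ℤ,
        xmin + (k : ℝ) * h ∈ Set.Icc xmin xmax → ymin + (l : ℝ) * h ∈ Set.Icc ymin ymax →
        |CCSL.cellAverage xmin ymin h (f t₁) k l
          - CCSL.update d xmin ymin h (X t₀ t₁) favg k l| ≤ C * h ^ 2 := by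
  have h0 : t₀ ∈ Set.Icc t₀ t₁ := Set.left_mem_Icc.2 ht.le
  have h1 : t₁ ∈ Set.Icc t₀ t₁ := Set.right_mem_Icc.2 ht.le
  -- The radius bounds the coordinates of the domain; the extra 1 covers the half cell between a
  -- centre and its face.
  obtain ⟨C, hC0, hC⟩ := CCSL.exists_abs_cellAverage_sub_update_le
    (CCSL.contDiff_slice (hXsmooth t₁ h1) h0) hXinv
    (CCSL.det_fderiv_backtracking_eq_one ht ha hdiv hX (hXsmooth t₁ h1)) hp hp'
    (CCSL.contDiff_slice hf h0) xmin ymin hd (|xmin| + |xmax| + |ymin| + |ymax| + 1)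
  refine ⟨C + 1, 1, by positivity, one_pos, fun h hh hh1 favg hfavg k l hk hl => ?_⟩
  have hft : f t₁ = fun z => f t₀ (X t₀ t₁ z) :=
    funext fun z => CCSL.solution_eq_along_characteristic ht ha hdiv hX hf hfsol z
  have hfa : favg = CCSL.cellAverage xmin ymin h (f t₀) := funext fun i => funext fun j => hfavg i j
  have hx0 := abs_le.1 (le_refl |xmin|)
  have hx1 := abs_le.1 (le_refl |xmax|)
  have hy0 := abs_le.1 (le_refl |ymin|)
  have hy1 := abs_le.1 (le_refl |ymax|)
  rw [hft, hfa]
  refine (hC h hh hh1 k l ?_ ?_).trans (by gcongr; linarith)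
  · rw [CCSL.face, abs_le]
    constructor <;> linarith [hk.1, hk.2, abs_nonneg ymin, abs_nonneg ymax]
  · rw [CCSL.face, abs_le]
    constructor <;> linarith [hl.1, hl.2, abs_nonneg xmin, abs_nonneg xmax]
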